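/- Let $M$ be a connected complex orbifold of dimension $n\ge 0$: a connected Hausdorff paracompact space $X$ with an atlas of orbifold charts, where a chart is a connected open set $\tilde U\subset\mathbb{C}^n$ with a biholomorphic action (not necessarily effective) of a finite group $\Gamma$ and a map $\tilde U\to X$ inducing a homeomorphism of $\tilde U/\Gamma$ onto an open subset of $X$, and where any two points of chart domains over the same point of $X$ are related by a change of charts, i.e. a biholomorphic map between open subsets of the chart domains compatible with the maps to $X$. Functions on $M$ are functions on $X$ (or on its open subsets), and they are called holomorphic or $C^\infty$ if their composites with the maps $\tilde U\to X$ are; $C^\infty$ differential forms on $M$ are families of complex-valued $C^\infty$ forms on the chart domains which are pulled back to each other by all changes of charts. Let $\mathcal{O}$ be the sheaf of holomorphic functions and $\mathbb{C}$ the constant sheaf on the underlying space $X$. Suppose that $H^0(M;\mathcal{O})=\mathbb{C}$, that is, every holomorphic function on $M$ is constant, and that $H^1(M;\mathbb{C})=0$ and $H^1(M;\mathcal{O})=0$ (sheaf cohomology on $X$). Let $\psi$ be a real $C^\infty$ $(1,1)$-form on $M$ which is $d$-exact, that is, $\psi=d\eta$ for some $C^\infty$ $1$-form $\eta$ on $M$.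 Then there exists a real-valued $C^\infty$ function $f$ on $M$ such that $$\psi=\frac{\sqrt{-1}}{2\pi}\,\partial\bar\partial f .$$ Such a function $f$ is unique up to an additive constant: if $f$ and $g$ are two such functions, then $f-g$ is constant. -/

import Mathlib

open CategoryTheory TopologicalSpace Opposite

universe u v w

/-! ### Complex orbifolds -/

/-- An `n`-dimensional complex orbifold chart on `X`: a connected open set `dom ⊆ ℂⁿ`, a finite
group `Γ` acting on it by biholomorphic maps (the action need not be effective), and a map `proj`
inducing a homeomorphism of the orbit space of `dom` by `Γ` onto an open subset of `X`, that is, a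
continuous open map whose fibres are the orbits.
The values of `act` and `proj` outside `dom` are irrelevant. -/
structure OrbifoldChart (n : ℕ) (X : Type u) [TopologicalSpace X] where
  dom : Set (Fin n → ℂ)
  isOpen_dom : IsOpen dom
  isConnected_dom : IsConnected dom
  Γ : Type w
  [group : Group Γ]
  [finite : Finite Γ]
  act : Γ → (Fin n → ℂ) → (Fin n → ℂ)
  act_mapsTo : ∀ g, Set.MapsTo (act g) dom dom
  act_one : ∀ z ∈ dom, act 1 z = z
  act_mul : ∀ g h, ∀ z ∈ dom, act (g * h) z = act g (act h z)
  act_holomorphic : ∀ g, DifferentiableOn ℂ (act g) dom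
  proj : (Fin n → ℂ) → X
  continuousOn_proj : ContinuousOn proj dom
  isOpen_image_proj : ∀ V ⊆ dom, IsOpen V → IsOpen (proj '' V)
  proj_eq_iff : ∀ z ∈ dom, ∀ z' ∈ dom, proj z = proj z' ↔ ∃ g, act g z = z'

attribute [instance] OrbifoldChart.group OrbifoldChart.finite

/-- A change of charts from `c` to `c'`: a biholomorphic map between an open subset of the domain
of `c` and an open subset of the domain of `c'` which covers the identity of `X`. -/
structure IsChangeOfCharts {n : ℕ} {X : Type u} [TopologicalSpace X]
    (c c' : OrbifoldChart.{u, w} n X)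
    (φ : OpenPartialHomeomorph (Fin n → ℂ) (Fin n → ℂ)) : Prop where
  source_subset : φ.source ⊆ c.dom
  target_subset : φ.target ⊆ c'.dom
  holomorphic : DifferentiableOn ℂ φ φ.source
  holomorphic_symm : DifferentiableOn ℂ φ.symm φ.target
  proj_apply : ∀ z ∈ φ.source, c'.proj (φ z) = c.proj z

set_option linter.checkUnivs false in
/-- The structure of an `n`-dimensional complex orbifold on a space `X`, given by an atlas of
orbifold charts which cover `X`; two points of chart domains lying over the same point of `X` are
related by a change of charts. (The underlying space of an orbifold is in addition required to be
Hausdorff and paracompact; this is expressed by the usual classes on `X`.) -/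
structure ComplexOrbifold (n : ℕ) (X : Type u) [TopologicalSpace X] where
  ι : Type v
  chart : ι → OrbifoldChart.{u, w} n X
  covers : ∀ x : X, ∃ i, ∃ z ∈ (chart i).dom, (chart i).proj z = x
  compatible : ∀ i j, ∀ z ∈ (chart i).dom, ∀ z' ∈ (chart j).dom,
    (chart i).proj z = (chart j).proj z' →
      ∃ φ, IsChangeOfCharts (chart i) (chart j) φ ∧ z ∈ φ.source ∧ φ z = z'

/-! ### Differential calculus on `ℂⁿ` -/

/-- The `ℂ`-linear part of an `ℝ`-linear map `L`, namely `v ↦ (L v - i L (i v)) / 2`. Applied to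
the derivative of `ω` this is `∑ⱼ dzⱼ ⊗ ∂ω/∂zⱼ`. -/
noncomputable def linearPart {n k : ℕ} (L : (Fin n → ℂ) →L[ℝ] (Fin n → ℂ) [⋀^Fin k]→L[ℝ] ℂ) :
    (Fin n → ℂ) →L[ℝ] (Fin n → ℂ) [⋀^Fin k]→L[ℝ] ℂ :=
  (1 / 2 : ℂ) • (L - Complex.I •
    (L.comp ((Complex.I • ContinuousLinearMap.id ℂ (Fin n → ℂ)).restrictScalars ℝ)))

/-- The `ℂ`-antilinear part of an `ℝ`-linear map `L`, namely `v ↦ (L v + i L (i v)) / 2`. Applied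
to the derivative of `ω` this is `∑ⱼ dz̄ⱼ ⊗ ∂ω/∂z̄ⱼ`. -/
noncomputable def antilinearPart {n k : ℕ} (L : (Fin n → ℂ) →L[ℝ] (Fin n → ℂ) [⋀^Fin k]→L[ℝ] ℂ) :
    (Fin n → ℂ) →L[ℝ] (Fin n → ℂ) [⋀^Fin k]→L[ℝ] ℂ :=
  (1 / 2 : ℂ) • (L + Complex.I •
    (L.comp ((Complex.I • ContinuousLinearMap.id ℂ (Fin n → ℂ)).restrictScalars ℝ)))

/-- The operator `∂ω = ∑ⱼ dzⱼ ∧ ∂ω/∂zⱼ` on complex-valued differential forms on `ℂⁿ`, normalized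
as the exterior derivative `extDeriv` of Mathlib. -/
noncomputable def del {n k : ℕ} (ω : (Fin n → ℂ) → (Fin n → ℂ) [⋀^Fin k]→L[ℝ] ℂ)
    (z : Fin n → ℂ) : (Fin n → ℂ) [⋀^Fin (k + 1)]→L[ℝ] ℂ :=
  .alternatizeUncurryFin (linearPart (fderiv ℝ ω z))

/-- The operator `∂̄ω = ∑ⱼ dz̄ⱼ ∧ ∂ω/∂z̄ⱼ` on complex-valued differential forms on `ℂⁿ`. -/
noncomputable def delbar {n k : ℕ} (ω : (Fin n → ℂ) → (Fin n → ℂ) [⋀^Fin k]→L[ℝ] ℂ)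
    (z : Fin n → ℂ) : (Fin n → ℂ) [⋀^Fin (k + 1)]→L[ℝ] ℂ :=
  .alternatizeUncurryFin (antilinearPart (fderiv ℝ ω z))

/-- A complex-valued function on `ℂⁿ` as a differential form of degree `0`. -/
noncomputable def zeroForm {n : ℕ} (h : (Fin n → ℂ) → ℂ) (z : Fin n → ℂ) :
    (Fin n → ℂ) [⋀^Fin 0]→L[ℝ] ℂ :=
  ContinuousAlternatingMap.constOfIsEmpty ℝ (Fin n → ℂ) (Fin 0) (h z)

/-! ### Smooth functions and differential forms on a complex orbifold -/

namespace ComplexOrbifold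

variable {n : ℕ} {X : Type u} [TopologicalSpace X]

/-- A real-valued function on a complex orbifold is `C^∞` if it is so in all charts. -/
def IsSmooth (M : ComplexOrbifold.{u, v, w} n X) (f : X → ℝ) : Prop :=
  ∀ i, ContDiffOn ℝ ((⊤ : ℕ∞) : WithTop ℕ∞) (fun z => f ((M.chart i).proj z)) (M.chart i).dom

/-- A complex-valued `C^∞` differential form of degree `k` on a complex orbifold: a family of
`C^∞` forms on the chart domains which are pulled back to each other by all changes of charts (in
particular, each of them is invariant under the group of its chart).
The values outside the chart domains are irrelevant. -/
structure SmoothForm (M : ComplexOrbifold.{u, v, w} n X) (k : ℕ) where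
  toFun : M.ι → (Fin n → ℂ) → (Fin n → ℂ) [⋀^Fin k]→L[ℝ] ℂ
  smooth : ∀ i, ContDiffOn ℝ ((⊤ : ℕ∞) : WithTop ℕ∞) (toFun i) (M.chart i).dom
  pullback : ∀ i j φ, IsChangeOfCharts (M.chart i) (M.chart j) φ → ∀ z ∈ φ.source,
    (toFun j (φ z)).compContinuousLinearMap (fderiv ℝ φ z) = toFun i z

/-- A differential form is real if its values are real numbers. -/
def SmoothForm.IsReal {M : ComplexOrbifold.{u, v, w} n X} {k : ℕ} (ψ : M.SmoothForm k) : Prop :=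
  ∀ i, ∀ z ∈ (M.chart i).dom, ∀ t, (ψ.toFun i z t).im = 0

/-- A form of degree `k = p + q` is of type `(p, q)` if multiplying all its arguments by `c ∈ ℂ`
multiplies its value by `c ^ p * c̄ ^ q`. -/
def SmoothForm.IsOfType {M : ComplexOrbifold.{u, v, w} n X} {k : ℕ} (ψ : M.SmoothForm k)
    (p q : ℕ) : Prop :=
  ∀ i, ∀ z ∈ (M.chart i).dom, ∀ (c : ℂ) (t : Fin k → Fin n → ℂ),
    ψ.toFun i z (fun a => c • t a) = c ^ p * (starRingEnd ℂ c) ^ q * ψ.toFun i z t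

/-- A form `ψ` of degree `k + 1` is `d`-exact if `ψ = dη` for some `C^∞` form `η` of degree `k`
on the whole orbifold. -/
def SmoothForm.IsExact {M : ComplexOrbifold.{u, v, w} n X} {k : ℕ} (ψ : M.SmoothForm (k + 1)) :
    Prop :=
  ∃ η : M.SmoothForm k, ∀ i, ∀ z ∈ (M.chart i).dom, ψ.toFun i z = extDeriv (η.toFun i) z

/-- The equation `ψ = (√-1 / 2π) ∂∂̄f` for a real-valued function `f`. -/
def SmoothForm.EqDelDelbar {M : ComplexOrbifold.{u, v, w} n X} (ψ : M.SmoothForm 2)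
    (f : X → ℝ) : Prop :=
  ∀ i, ∀ z ∈ (M.chart i).dom, ψ.toFun i z =
    (Complex.I / (2 * Real.pi)) •
      del (delbar (zeroForm fun z' => (f ((M.chart i).proj z') : ℂ))) z

end ComplexOrbifold

/-! ### Sheaves of functions -/

/-- The restriction of a function on `U` to a smaller open set `V`. -/
def restrictFun {X : Type u} [TopologicalSpace X] {U V : Opens X} (h : V ≤ U) :
    (U → ℂ) →+ (V → ℂ) where
  toFun s x := s ⟨x.1, h x.2⟩
  map_zero' := rfl
  map_add' _ _ := rfl

/-- An additive and local condition on complex-valued functions on the open subsets of `X`. -/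
structure FunctionCondition (X : Type u) [TopologicalSpace X] where
  sections : ∀ U : Opens X, AddSubgroup (U → ℂ)
  restrict : ∀ {U V : Opens X} (h : V ≤ U), ∀ s ∈ sections U, restrictFun h s ∈ sections V
  locality : ∀ (U : Opens X) (s : U → ℂ),
    (∀ x : U, ∃ (V : Opens X) (h : V ≤ U), x.1 ∈ V ∧ restrictFun h s ∈ sections V) →
      s ∈ sections U

namespace FunctionCondition

variable {X : Type u} [TopologicalSpace X]

/-- The presheaf of abelian groups of the functions satisfying the condition. -/
def presheaf (P : FunctionCondition X) : (Opens X)ᵒᵖ ⥤ AddCommGrpCat.{u} where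
  obj U := AddCommGrpCat.of (P.sections U.unop)
  map {U V} h := AddCommGrpCat.ofHom
    (((restrictFun h.unop.le).comp (P.sections U.unop).subtype).codRestrict (P.sections V.unop)
      fun s => P.restrict h.unop.le s.1 s.2)

theorem isSheaf_presheaf (P : FunctionCondition X) :
    Presheaf.IsSheaf (Opens.grothendieckTopology X) P.presheaf := by
  let Q : TopCat.LocalPredicate (X := TopCat.of X) (fun _ => ℂ) :=
    { pred := fun {U} s => s ∈ P.sections U
      res := fun {U V} i s hs => P.restrict i.le s hs
      locality := fun {U} s hs => P.locality U s fun x => by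
        obtain ⟨V, hx, i, hV⟩ := hs x
        exact ⟨V, i.le, hx, hV⟩ }
  have h := TopCat.subpresheafToTypes.isSheaf Q
  exact (TopCat.Presheaf.isSheaf_iff_isSheaf_comp (X := TopCat.of X)
    (forget AddCommGrpCat.{u}) P.presheaf).2 h

/-- The sheaf of abelian groups of the functions satisfying the condition. -/
def sheaf (P : FunctionCondition X) :
    Sheaf (Opens.grothendieckTopology X) AddCommGrpCat.{u} :=
  ⟨P.presheaf, P.isSheaf_presheaf⟩

end FunctionCondition

/-- The functions on open subsets of `X` which are locally constant. -/
def locallyConstantFunctions (X : Type u) [TopologicalSpace X] : FunctionCondition X where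
  sections U :=
    { carrier := {s | IsLocallyConstant s}
      zero_mem' := IsLocallyConstant.const 0
      add_mem' := fun ha hb => ha.add hb
      neg_mem' := fun ha => ha.neg }
  restrict {U V} h s hs := by
    exact IsLocallyConstant.comp_continuous (f := fun x : V => (⟨x.1, h x.2⟩ : U)) hs
      (by fun_prop)
  locality U s hs := by
    change IsLocallyConstant s
    rw [IsLocallyConstant.iff_exists_open]
    intro x
    obtain ⟨V, h, hx, hV⟩ := hs x
    obtain ⟨W, hW, hxW, hc⟩ := IsLocallyConstant.exists_open hV ⟨x.1, hx⟩
    obtain ⟨W', hW', rfl⟩ := isOpen_induced_iff.1 hW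
    refine ⟨Subtype.val ⁻¹' (W' ∩ V), (hW'.inter V.isOpen).preimage continuous_subtype_val,
      ⟨hxW, hx⟩, fun y hy => ?_⟩
    exact hc ⟨y.1, hy.2⟩ hy.1

namespace ComplexOrbifold

variable {n : ℕ} {X : Type u} [TopologicalSpace X]

/-- A function `s` on an open subset `U` of a complex orbifold is holomorphic if its composite
with the projection of each chart is. -/
def IsHolomorphic (M : ComplexOrbifold.{u, v, w} n X) {U : Opens X} (s : U → ℂ) : Prop :=
  ∀ i, DifferentiableOn ℂ (fun z => Function.extend Subtype.val s (0 : X → ℂ) ((M.chart i).proj z))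
    ((M.chart i).dom ∩ (M.chart i).proj ⁻¹' U)

/-- The holomorphic functions on open subsets of a complex orbifold. -/
def holomorphicFunctions (M : ComplexOrbifold.{u, v, w} n X) : FunctionCondition X where
  sections U :=
    { carrier := {s | M.IsHolomorphic s}
      zero_mem' := fun i => (differentiableOn_const (0 : ℂ)).congr fun z hz => by
        exact Subtype.val_injective.extend_apply (0 : U → ℂ) 0 ⟨_, hz.2⟩
      add_mem' := fun {a b} ha hb i => ((ha i).add (hb i)).congr fun z hz => by
        have e (s : U → ℂ) := Subtype.val_injective.extend_apply s (0 : X → ℂ) ⟨_, hz.2⟩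
        exact (e _).trans (by rw [Pi.add_apply, ← e a, ← e b]; rfl)
      neg_mem' := fun {a} ha i => (ha i).neg.congr fun z hz => by
        have e (s : U → ℂ) := Subtype.val_injective.extend_apply s (0 : X → ℂ) ⟨_, hz.2⟩
        exact (e _).trans (by rw [Pi.neg_apply, Pi.neg_apply, ← e a]) }
  restrict {U V} h s hs i := by
    refine ((hs i).mono fun z hz => ⟨hz.1, h hz.2⟩).congr fun z hz => ?_
    exact (Subtype.val_injective.extend_apply _ (0 : X → ℂ) ⟨_, hz.2⟩).trans
      (Subtype.val_injective.extend_apply s (0 : X → ℂ) ⟨_, h hz.2⟩).symm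
  locality U s hs i := by
    intro z hz
    obtain ⟨V, h, hx, hV⟩ := hs ⟨_, hz.2⟩
    have hn : (M.chart i).dom ∩ (M.chart i).proj ⁻¹' V ∈ nhds z :=
      ((M.chart i).continuousOn_proj.isOpen_inter_preimage (M.chart i).isOpen_dom
        V.isOpen).mem_nhds ⟨hz.1, hx⟩
    refine (((hV i).differentiableAt hn).congr_of_eventuallyEq
      (Filter.mem_of_superset hn fun y hy => ?_)).differentiableWithinAt
    exact (Subtype.val_injective.extend_apply s (0 : X → ℂ) ⟨_, h hy.2⟩).trans
      (Subtype.val_injective.extend_apply (restrictFun h s) (0 : X → ℂ) ⟨_, hy.2⟩).symm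

/-- The sheaf `𝒪` of holomorphic functions on the underlying space of a complex orbifold. -/
def structureSheaf (M : ComplexOrbifold.{u, v, w} n X) :
    Sheaf (Opens.grothendieckTopology X) AddCommGrpCat.{u} :=
  M.holomorphicFunctions.sheaf

end ComplexOrbifold

/-- The constant sheaf `ℂ` on `X`, that is, the sheaf of locally constant functions. -/
def constantSheafC (X : Type u) [TopologicalSpace X] :
    Sheaf (Opens.grothendieckTopology X) AddCommGrpCat.{u} :=
  (locallyConstantFunctions X).sheaf

/-!
The two halves of the theorem are instances of one argument on an orbifold `M`. Let `A` be either
the identity or the projection `conjLinearPart` of an `ℝ`-linear form to its `ℂ`-antilinear part, and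
consider the equation `A (ds) = θ` for a function `s`, i.e. `ds = θ` or `∂̄s = θ`. Suppose that it can
be solved near every point of every chart domain. Averaging a solution over the stabilizer of a point
gives solutions on the members of an open cover of the space `X`
(`IsCompatibleFamily.exists_isSolution_nhds`). On the overlaps they differ by solutions of
`A (ds) = 0`, which are the sections of the constant sheaf or of the structure sheaf. If the first
cohomology of that sheaf vanishes, the local solutions can be corrected to a global one
(`FunctionCondition.exists_sub_mem_sections`, `IsCompatibleFamily.exists_isSolution_univ`). For this
step the sheaf is embedded in the sheaf of all functions, so that no partition of unity is needed.

Existence uses the case of `∂̄`. Let `ψ = dη`, where `η` may be replaced by its real part because `ψ`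
is real. As `ψ` has no `(0,2)`-part, the `(0,1)`-part of `η` is `∂̄`-closed, and it is locally
`∂̄`-exact by the `∂̄`-Poincaré lemma (`exists_conjLinearPart_fderiv_eq`). Hence it equals `∂̄t` for a
global function `t`. Then `η = ∂̄t + ∂t̄`, where `t̄` is the conjugate of `t`, and
`ψ = ∂∂̄(t - t̄) = 2i ∂∂̄ (Im t)`, so that `f = 4π Im t` is a potential of `ψ`.

Uniqueness uses the case of `d`. If `h` is the difference of two potentials, then `∂h` is closed,
locally exact by the Poincaré lemma, and so `∂h = dt` for a global function `t`. The function `t` is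
holomorphic because `dt` has type `(1,0)`, hence constant; so `∂h = 0`, and `dh = 0` because `h` is
real.

The `∂̄`-Poincaré lemma is proved by removing the differentials `dz̄ⱼ` one at a time with Cauchy
transforms in one variable; that these invert `∂/∂z̄` is the Cauchy–Pompeiu formula
(`integral_inv_mul_dbar_eq`). Changes of charts are only assumed to be complex differentiable, and
their smoothness follows from Cauchy's formula on complex lines
(`DifferentiableOn.contDiffOn_of_complex`).
-/

/-! ### The additive Cousin problem for sheaves of functions -/

namespace FunctionCondition

variable {X : Type u} [TopologicalSpace X]

/-- The condition satisfied by all functions. -/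
def all (X : Type u) [TopologicalSpace X] : FunctionCondition X where
  sections _ := ⊤
  restrict _ _ _ := trivial
  locality _ _ _ := trivial

/-- The inclusion of a sheaf of functions in the sheaf of all functions. -/
def toAll (P : FunctionCondition X) : P.sheaf ⟶ (all X).sheaf where
  hom :=
    { app := fun U => AddCommGrpCat.ofHom
        ((P.sections U.unop).subtype.codRestrict ((all X).sections U.unop) fun _ => trivial)
      naturality := fun _ _ _ => rfl }

instance (P : FunctionCondition X) : Mono P.toAll := by
  have h : Mono P.toAll.hom := by
    have : ∀ U, Mono (P.toAll.hom.app U) := fun U =>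
      (AddCommGrpCat.mono_iff_injective _).2 fun a b h =>
        Subtype.ext (congrArg (fun s : (all X).sections U.unop => s.1) h)
    exact NatTrans.mono_of_mono_app _
  exact (sheafToPresheaf _ _).mono_of_mono_map h

/-- The additive Cousin problem for a sheaf of functions with vanishing first cohomology: functions
given on the members of an open cover whose differences on the overlaps are sections of the sheaf
differ from a single global function by sections of the sheaf. No regularity of the given functions
is needed, as the sheaf is embedded in the sheaf of all functions. -/
theorem exists_sub_mem_sections (P : FunctionCondition X) (hP : Subsingleton (Sheaf.H P.sheaf 1))
    {κ : Type*} (V : κ → Opens X) (hV : ∀ x, ∃ a, x ∈ V a) (s : κ → X → ℂ)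
    (hs : ∀ a b, (fun p : ↥(V a ⊓ V b) => s a p - s b p) ∈ P.sections (V a ⊓ V b)) :
    ∃ t : X → ℂ, ∀ a, (fun p : V a => t p - s a p) ∈ P.sections (V a) := by
  let S : ShortComplex (Sheaf (Opens.grothendieckTopology X) AddCommGrpCat.{u}) :=
    ShortComplex.mk P.toAll (Limits.cokernel.π P.toAll) (Limits.cokernel.condition _)
  have hex : S.Exact := ShortComplex.exact_cokernel _
  have hS : S.ShortExact := { exact := hex, mono_f := inferInstanceAs (Mono P.toAll),
                              epi_g := inferInstanceAs (Epi (Limits.cokernel.π _)) }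
  let r : ∀ U : Opens X, (X → ℂ) → S.X₂.obj.obj (op U) := fun U f => ⟨fun p => f p, trivial⟩
  have hr : ∀ {U U' : Opens X} (i : U' ⟶ U) (f : X → ℂ), S.X₂.obj.map i.op (r U f) = r U' f :=
    fun _ _ => rfl
  have hr_sub : ∀ U f g, r U f - r U g = r U (f - g) := fun _ _ _ => rfl
  have key : ∀ (U : Opens X) (f g : X → ℂ), S.g.hom.app (op U) (r U f) = S.g.hom.app (op U) (r U g) ↔
      (fun p : U => f p - g p) ∈ P.sections U := by
    intro U f g
    rw [← sub_eq_zero, ← map_sub, hr_sub]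
    constructor
    · intro h
      obtain ⟨b, hb⟩ := TopCat.Sheaf.sections_exact_of_left_exact (X := TopCat.of X) (S := S)
        hS.1 hS.2 (r U (f - g)) h
      have := congrArg (fun s : (all X).sections U => s.1) hb
      have h2 : (fun p : U => f p - g p) = b.1 := this.symm
      rw [h2]
      exact b.2
    · intro h
      have h0 : S.f.hom.app (op U) ≫ S.g.hom.app (op U) = 0 := by
        rw [← NatTrans.comp_app, ← ObjectProperty.FullSubcategory.comp_hom, S.zero]
        rfl
      exact congrArg (fun m => AddCommGrpCat.Hom.hom m
        (⟨fun p : U => f p - g p, h⟩ : P.sections U)) h0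
  obtain ⟨q, hq, -⟩ := TopCat.Sheaf.existsUnique_gluing' (X := TopCat.of X) S.X₃ V ⊤
    (fun a => homOfLE le_top)
    (fun x _ => by obtain ⟨a, ha⟩ := hV x; exact Opens.mem_iSup.2 ⟨a, ha⟩)
    (fun a => S.g.hom.app (op (V a)) (r (V a) (s a))) (fun a b => by
      have h1 := NatTrans.naturality_apply S.g.hom (homOfLE inf_le_left : V a ⊓ V b ⟶ V a).op
        (r (V a) (s a))
      have h2 := NatTrans.naturality_apply S.g.hom (homOfLE inf_le_right : V a ⊓ V b ⟶ V b).op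
        (r (V b) (s b))
      refine h1.symm.trans (Eq.trans ?_ h2)
      rw [hr, hr]
      exact (key _ _ _).2 (hs a b))
  let T : Limits.IsTerminal (⊤ : Opens X) := Limits.isTerminalTop
  obtain ⟨x₂, hx₂⟩ := Abelian.Ext.covariant_sequence_exact₃ _ hS
    ((Sheaf.H.equiv₀ S.X₃ T).symm q) (zero_add 1) (hP.elim _ _)
  obtain ⟨t, ht⟩ : ∃ t : X → ℂ, r ⊤ t = Sheaf.H.equiv₀ S.X₂ T x₂ :=
    ⟨fun p => (Sheaf.H.equiv₀ S.X₂ T x₂).1 ⟨p, trivial⟩, rfl⟩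
  have htq : S.g.hom.app (op ⊤) (r ⊤ t) = q := by
    rw [ht, Sheaf.H.equiv₀_naturality]
    exact (AddEquiv.eq_symm_apply _).1 hx₂
  refine ⟨t, fun a => (key _ _ _).1 ?_⟩
  rw [← hq a, ← htq, ← hr (homOfLE le_top : V a ⟶ ⊤)]
  exact NatTrans.naturality_apply S.g.hom (homOfLE le_top : V a ⟶ ⊤).op (r ⊤ t)

end FunctionCondition

/-! ### Smoothness of holomorphic functions of several variables -/

section Holomorphic

open Metric

variable {E : Type*} [NormedAddCommGroup E] [NormedSpace ℂ E] [FiniteDimensional ℂ E]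

/-- A directional derivative of a holomorphic function is again holomorphic: Cauchy's formula on a
complex line writes it as an integral depending holomorphically on the point. -/
theorem DifferentiableOn.fderiv_apply_const_of_complex {f : E → ℂ} {s : Set E} (hs : IsOpen s)
    (hf : DifferentiableOn ℂ f s) (v : E) : DifferentiableOn ℂ (fun x => fderiv ℂ f x v) s := by
  have : ProperSpace E := FiniteDimensional.proper ℂ E
  have : ProperSpace (E →L[ℂ] ℂ) := FiniteDimensional.proper ℂ _
  borelize E
  borelize (E →L[ℂ] ℂ)
  intro x₀ hx₀
  obtain ⟨ρ, hρ, hball⟩ : ∃ ρ > 0, ball x₀ ρ ⊆ s ∩ f ⁻¹' ball (f x₀) 1 :=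
    Metric.mem_nhds_iff.1 (Filter.inter_mem (hs.mem_nhds hx₀)
      ((hf.differentiableAt (hs.mem_nhds hx₀)).continuousAt (ball_mem_nhds _ one_pos)))
  have hd : DifferentiableOn ℂ f (ball x₀ ρ) := hf.mono fun x hx => (hball hx).1
  have hda : ∀ p ∈ ball x₀ ρ, DifferentiableAt ℂ f p := fun p hp =>
    hd.differentiableAt (isOpen_ball.mem_nhds hp)
  obtain ⟨r, hr, hrv⟩ : ∃ r > 0, r * ‖v‖ < ρ / 4 := by
    refine ⟨ρ / 4 / (‖v‖ + 1), by positivity, ?_⟩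
    rw [div_mul_eq_mul_div, div_lt_iff₀ (by positivity)]
    nlinarith
  have hmem : ∀ y ∈ ball x₀ (ρ / 4), ∀ ζ : ℂ, ‖ζ‖ ≤ r → y + ζ • v ∈ ball x₀ (ρ / 2) := by
    intro y hy ζ hζ
    rw [mem_ball, dist_eq_norm] at hy ⊢
    have h1 : ‖ζ • v‖ ≤ r * ‖v‖ := by rw [norm_smul]; gcongr
    have h2 : y + ζ • v - x₀ = (y - x₀) + ζ • v := by abel
    have := norm_add_le (y - x₀) (ζ • v)
    rw [h2]
    linarith
  have hsub : ball x₀ (ρ / 2) ⊆ ball x₀ ρ := ball_subset_ball (by linarith)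
  have hbound : ∀ p ∈ ball x₀ (ρ / 2), ‖fderiv ℂ f p‖ ≤ 2 / (ρ / 2) := by
    intro p hp
    have hpb : ball p (ρ / 2) ⊆ ball x₀ ρ := ball_subset_ball' (by
      have := mem_ball.1 hp
      linarith)
    refine Complex.norm_fderiv_le_div_of_mapsTo_ball (hd.mono hpb) (fun q hq => ?_) (by positivity)
    have h1 := mem_ball.1 (hball (hpb hq)).2
    have h2 := mem_ball.1 (hball (hsub hp)).2
    rw [mem_closedBall]
    have := dist_triangle_right (f q) (f p) (f x₀)
    linarith
  -- `K θ` collects the factors of Cauchy's formula which do not involve `f`.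
  let K : ℝ → ℂ := fun θ => _root_.deriv (circleMap 0 r) θ * ((circleMap 0 r θ - 0) ^ 2)⁻¹
  have hKc : Continuous K := by
    simp only [K, deriv_circleMap]
    have : ∀ θ, (circleMap 0 r θ - 0) ^ 2 ≠ 0 := fun θ => by
      simpa using hr.ne'
    fun_prop (disch := assumption)
  have hζ : ∀ θ, ‖circleMap 0 r θ‖ ≤ r := fun θ => by simp [abs_of_pos hr]
  have hline : ∀ y, Continuous fun θ : ℝ => y + circleMap 0 r θ • v := fun y => by fun_prop
  have hFc : ∀ y ∈ ball x₀ (ρ / 4), Continuous fun θ : ℝ => K θ * f (y + circleMap 0 r θ • v) :=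
    fun y hy => hKc.mul (hd.continuousOn.comp_continuous (hline y)
      fun θ => hsub (hmem y hy _ (hζ θ)))
  have hG : HasFDerivAt (fun y => ∫ θ in (0 : ℝ)..2 * Real.pi, K θ * f (y + circleMap 0 r θ • v))
      (∫ θ in (0 : ℝ)..2 * Real.pi, K θ • fderiv ℂ f (x₀ + circleMap 0 r θ • v)) x₀ := by
    have hx₀' : x₀ ∈ ball x₀ (ρ / 4) := mem_ball_self (by positivity)
    refine intervalIntegral.hasFDerivAt_integral_of_dominated_of_fderiv_le
      (F' := fun y θ => K θ • fderiv ℂ f (y + circleMap 0 r θ • v))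
      (s := ball x₀ (ρ / 4)) (bound := fun θ => ‖K θ‖ * (2 / (ρ / 2)))
      (ball_mem_nhds _ (by positivity)) ?_ ((hFc x₀ hx₀').intervalIntegrable _ _) ?_ ?_
      ((hKc.norm.mul continuous_const).intervalIntegrable _ _) ?_
    · filter_upwards [ball_mem_nhds x₀ (by positivity : 0 < ρ / 4)] with y hy
      exact (hFc y hy).aestronglyMeasurable
    · exact hKc.aestronglyMeasurable.smul
        ((measurable_fderiv ℂ f).comp (hline x₀).measurable).aestronglyMeasurable
    · refine Filter.Eventually.of_forall fun θ _ y hy => ?_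
      rw [norm_smul]
      gcongr
      exact hbound _ (hmem y hy _ (hζ θ))
    · refine Filter.Eventually.of_forall fun θ _ y hy => ?_
      have h1 := (hda _ (hsub (hmem y hy _ (hζ θ)))).hasFDerivAt
      have h2 : HasFDerivAt (fun y => f (y + circleMap 0 r θ • v))
          (fderiv ℂ f (y + circleMap 0 r θ • v)) y :=
        h1.comp y ((hasFDerivAt_id y).add_const (circleMap 0 r θ • v))
      exact h2.const_mul (K θ)
  refine ((hG.differentiableAt.const_smul (2 * Real.pi * Complex.I)⁻¹).congr_of_eventuallyEq
    ?_).differentiableWithinAt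
  filter_upwards [ball_mem_nhds x₀ (by positivity : 0 < ρ / 4)] with y hy
  let U : Set ℂ := (fun ζ : ℂ => y + ζ • v) ⁻¹' ball x₀ ρ
  have hU : IsOpen U := isOpen_ball.preimage (by fun_prop)
  have hg : ∀ ζ ∈ U, HasDerivAt (fun ζ : ℂ => f (y + ζ • v)) (fderiv ℂ f (y + ζ • v) v) ζ := by
    intro ζ hζ
    have h1 : HasDerivAt (fun ζ : ℂ => y + ζ • v) v ζ := by
      simpa using ((hasDerivAt_id ζ).smul_const v).const_add y
    exact (hda _ hζ).hasFDerivAt.comp_hasDerivAt ζ h1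
  have h0 : (0 : ℂ) ∈ U := by
    simpa [U] using ball_subset_ball (by linarith : ρ / 4 ≤ ρ) hy
  have hc := Complex.two_pi_I_inv_smul_circleIntegral_sub_sq_inv_smul_of_differentiable hU
    (c := 0) (w₀ := 0) (R := r) (f := fun ζ : ℂ => f (y + ζ • v))
    (fun ζ hζ => hsub (hmem y hy ζ (by simpa using hζ)))
    (fun ζ hζ => (hg ζ hζ).differentiableAt.differentiableWithinAt) (mem_ball_self hr)
  rw [(hg 0 h0).deriv, zero_smul, add_zero] at hc
  rw [← hc]
  simp [circleIntegral, K, mul_assoc]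

/-- A function of several complex variables which is complex differentiable on an open set is
smooth there. -/
theorem DifferentiableOn.contDiffOn_of_complex {f : E → ℂ} {s : Set E} (hs : IsOpen s)
    (hf : DifferentiableOn ℂ f s) : ContDiffOn ℂ ((⊤ : ℕ∞) : WithTop ℕ∞) f s := by
  rw [contDiffOn_infty]
  intro m
  induction m generalizing f with
  | zero => exact contDiffOn_zero.2 hf.continuousOn
  | succ m ih =>
    push_cast
    rw [contDiffOn_succ_iff_fderiv_apply hs.uniqueDiffOn]
    refine ⟨hf, fun h => by simp at h, fun y => ?_⟩
    refine (ih (hf.fderiv_apply_const_of_complex hs y)).congr fun x hx => ?_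
    rw [fderivWithin_of_isOpen hs hx]

end Holomorphic

/-! ### The Cauchy–Pompeiu formula -/

section CauchyPompeiu

open MeasureTheory Set Real

/-- The **Cauchy–Pompeiu formula** for compactly supported functions: `1 / (π w)` is a fundamental
solution of `∂/∂w̄`. In polar coordinates `w = r e^{iθ}` the integrand is
`(∂h/∂r + (i / r) ∂h/∂θ) / 2`; the first term integrates to `- π h(0)` along the rays and the second
one to `0` along the circles. -/
theorem integral_inv_mul_dbar_eq {h : ℂ → ℂ} (hh : ContDiff ℝ 1 h) (hc : HasCompactSupport h) :
    ∫ w, w⁻¹ * ((1 / 2 : ℂ) * (fderiv ℝ h w 1 + Complex.I * fderiv ℝ h w Complex.I)) =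
      -(π * h 0) := by
  let e : ℝ → ℂ := fun θ => Real.cos θ + Real.sin θ * Complex.I
  have he : Continuous e := by fun_prop
  have hdh : Continuous (fderiv ℝ h) := hh.continuous_fderiv one_ne_zero
  have hd : ∀ w, HasFDerivAt h (fderiv ℝ h w) w := fun w =>
    (hh.differentiable one_ne_zero w).hasFDerivAt
  let A : ℝ × ℝ → ℂ := fun p => fderiv ℝ h (p.1 * e p.2) (e p.2)
  let B : ℝ × ℝ → ℂ := fun p => fderiv ℝ h (p.1 * e p.2) (Complex.I * e p.2)
  have hA : Continuous A := by fun_prop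
  have hB : Continuous B := by fun_prop
  obtain ⟨R, hR⟩ : ∃ R, ∀ w, R < ‖w‖ → fderiv ℝ h w = 0 := by
    obtain ⟨R, hR⟩ := (hc.fderiv ℝ).isCompact.isBounded.subset_closedBall 0
    refine ⟨R, fun w hw => image_eq_zero_of_notMem_tsupport fun hw' => ?_⟩
    have := hR hw'
    rw [mem_closedBall_zero_iff] at this
    linarith
  have hnorm : ∀ p : ℝ × ℝ, ‖(p.1 * e p.2 : ℂ)‖ = |p.1| := fun p => by
    simp only [e, norm_mul, Complex.norm_real, Complex.ofReal_cos, Complex.ofReal_sin,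
      Complex.norm_cos_add_sin_mul_I, mul_one, Real.norm_eq_abs]
  have hint : ∀ C : ℝ × ℝ → ℂ, Continuous C → (∀ p : ℝ × ℝ, R < p.1 → 0 < p.1 → C p = 0) →
      IntegrableOn C (Ioi 0 ×ˢ Ioo (-π) π) (volume.prod volume) := by
    intro C hC h0
    refine IntegrableOn.of_forall_sdiff_eq_zero
      (hC.continuousOn.integrableOn_compact ((isCompact_Icc (a := 0) (b := R)).prod
        (isCompact_Icc (a := -π) (b := π)))) (measurableSet_Ioi.prod measurableSet_Ioo) ?_
    rintro ⟨r, θ⟩ ⟨⟨h1, h2⟩, h3⟩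
    refine h0 _ ?_ h1
    by_contra hle
    exact h3 ⟨⟨(mem_Ioi.1 h1).le, not_lt.1 hle⟩, h2.1.le, h2.2.le⟩
  have hAi : IntegrableOn A (Ioi 0 ×ˢ Ioo (-π) π) (volume.prod volume) := hint A hA
    fun p hp hp0 => by simp only [A]; rw [hR _ (by rwa [hnorm, abs_of_pos hp0])]; rfl
  have hBi : IntegrableOn B (Ioi 0 ×ˢ Ioo (-π) π) (volume.prod volume) := hint B hB
    fun p hp hp0 => by simp only [B]; rw [hR _ (by rwa [hnorm, abs_of_pos hp0])]; rfl
  have hAint : ∫ p in Ioi 0 ×ˢ Ioo (-π) π, A p ∂(volume.prod volume) = -(2 * π * h 0) := by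
    rw [← Measure.prod_restrict, integral_prod_symm _ (by rwa [Measure.prod_restrict])]
    have : ∀ θ : ℝ, ∫ r in Ioi 0, A (r, θ) = - h 0 := by
      intro θ
      have hder : ∀ r : ℝ, HasDerivAt (fun r : ℝ => h (r * e θ)) (A (r, θ)) r := fun r => by
        have h1 : HasDerivAt (fun r : ℝ => (r : ℂ) * e θ) (e θ) r := by
          simpa using (Complex.ofRealCLM.hasDerivAt (x := r)).mul_const (e θ)
        exact (hd _).comp_hasDerivAt r h1
      have hcs : HasCompactSupport fun r : ℝ => h (r * e θ) := by
        obtain ⟨R', hR'⟩ := hc.isCompact.isBounded.subset_closedBall 0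
        refine HasCompactSupport.intro (isCompact_closedBall (0 : ℝ) R') fun r hr => ?_
        refine image_eq_zero_of_notMem_tsupport fun h' => hr ?_
        have := hR' h'
        rw [mem_closedBall_zero_iff] at this ⊢
        rwa [hnorm (r, θ)] at this
      have := HasCompactSupport.integral_Ioi_deriv_eq
        (hh.comp (g := h) (f := fun r : ℝ => (r : ℂ) * e θ)
          (Complex.ofRealCLM.contDiff.mul contDiff_const)) hcs 0
      simp only [Function.comp_def, (hder _).deriv] at this
      rw [this]
      simp
    simp only [this]
    rw [integral_const]
    simp only [measureReal_restrict_apply_univ, Real.volume_real_Ioo_of_le (by linarith [pi_pos] :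
      -π ≤ π), Complex.real_smul]
    push_cast
    ring
  have hBint : ∫ p in Ioi 0 ×ˢ Ioo (-π) π, B p ∂(volume.prod volume) = 0 := by
    rw [← Measure.prod_restrict, integral_prod _ (by rwa [Measure.prod_restrict])]
    refine (setIntegral_congr_fun measurableSet_Ioi fun r hr => ?_).trans (integral_zero _ _)
    have hr : (r : ℂ) ≠ 0 := by exact_mod_cast (mem_Ioi.1 hr).ne'
    have hder : ∀ θ : ℝ, HasDerivAt (fun θ : ℝ => (r : ℂ)⁻¹ * h (r * e θ)) (B (r, θ)) θ := by
      intro θ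
      have h1 : HasDerivAt (fun θ : ℝ => (r : ℂ) * e θ) (r • (Complex.I * e θ)) θ := by
        have h2 : HasDerivAt e (-Real.sin θ + Real.cos θ * Complex.I) θ := by
          have hcos := (Real.hasDerivAt_cos θ).ofReal_comp
          have hsin := (Real.hasDerivAt_sin θ).ofReal_comp
          convert! hcos.add (hsin.mul_const Complex.I) using 1
          rw [Complex.ofReal_neg]
        convert! h2.const_mul (r : ℂ) using 1
        simp only [e, Complex.real_smul]
        linear_combination (r * Real.sin θ : ℂ) * Complex.I_sq
      have h3 := ((hd _).comp_hasDerivAt θ h1).const_mul (r : ℂ)⁻¹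
      convert! h3 using 1
      simp only [B, map_smul]
      rw [Complex.real_smul, inv_mul_cancel_left₀ hr]
    have := intervalIntegral.integral_eq_sub_of_hasDerivAt (a := -π) (b := π)
      (fun θ _ => hder θ) ((hB.comp
        (by fun_prop : Continuous fun θ : ℝ => (r, θ))).intervalIntegrable _ _)
    rw [intervalIntegral.integral_of_le (by linarith [pi_pos]), integral_Ioc_eq_integral_Ioo] at this
    simp only [this, e]
    simp
  rw [← Complex.integral_comp_polarCoord_symm, polarCoord_target]
  have hcongr : ∀ p ∈ Ioi (0 : ℝ) ×ˢ Ioo (-π) π,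
      p.1 • ((Complex.polarCoord.symm p)⁻¹ * ((1 / 2 : ℂ) *
        (fderiv ℝ h (Complex.polarCoord.symm p) 1 +
          Complex.I * fderiv ℝ h (Complex.polarCoord.symm p) Complex.I))) =
      (1 / 2 : ℂ) * (A p + Complex.I * B p) := by
    rintro ⟨r, θ⟩ ⟨hr, -⟩
    have hr : (r : ℂ) ≠ 0 := by exact_mod_cast (mem_Ioi.1 hr).ne'
    have hexp : e θ = Real.cos θ • (1 : ℂ) + Real.sin θ • Complex.I := by simp [e]
    have hexp' : Complex.I * e θ = (-Real.sin θ) • (1 : ℂ) + Real.cos θ • Complex.I := by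
      simp only [e, Complex.real_smul, Complex.ofReal_neg]
      linear_combination (Real.sin θ : ℂ) * Complex.I_sq
    have hinv : e θ * (Real.cos θ - Real.sin θ * Complex.I) = 1 := by
      have : (Real.cos θ : ℂ) ^ 2 + (Real.sin θ : ℂ) ^ 2 = 1 := by
        exact_mod_cast Real.cos_sq_add_sin_sq θ
      simp only [e]
      linear_combination this - (Real.sin θ : ℂ) ^ 2 * Complex.I_sq
    have hinv' : (e θ)⁻¹ = Real.cos θ - Real.sin θ * Complex.I := inv_eq_of_mul_eq_one_right hinv
    have hpol : Complex.polarCoord.symm (r, θ) = r * e θ := by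
      rw [Complex.polarCoord_symm_apply]
    simp only [A, B, hpol]
    rw [mul_inv, hinv', hexp', ← hpol, hexp]
    simp only [map_add, map_smul]
    simp only [Complex.real_smul, Complex.ofReal_neg]
    field_simp
    linear_combination ((Real.sin θ : ℂ) * fderiv ℝ h (Complex.polarCoord.symm (r, θ)) Complex.I) *
      (-Complex.I_sq)
  have hmeas : MeasurableSet (Ioi (0 : ℝ) ×ˢ Ioo (-π) π) := measurableSet_Ioi.prod measurableSet_Ioo
  rw [setIntegral_congr_fun hmeas hcongr, integral_const_mul, Measure.volume_eq_prod,
    integral_add hAi (hBi.const_mul _), integral_const_mul, hAint, hBint]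
  ring

end CauchyPompeiu

/-! ### Antilinear parts of derivatives -/

section ConjLinearPart

variable {n : ℕ}

/-- The `ℂ`-antilinear part `v ↦ (L v + i L (i v)) / 2` of an `ℝ`-linear form `L` on `ℂⁿ`. The
equation `conjLinearPart (fderiv ℝ u z) = conjLinearPart (ω z)` says that `∂̄u` is the `(0,1)`-part
of the `1`-form `ω`. -/
noncomputable def conjLinearPart : ((Fin n → ℂ) →L[ℝ] ℂ) →L[ℝ] ((Fin n → ℂ) →L[ℝ] ℂ) :=
  (1 / 2 : ℂ) • (ContinuousLinearMap.id ℝ _ + Complex.I •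
    (ContinuousLinearMap.compL ℝ (Fin n → ℂ) (Fin n → ℂ) ℂ).flip
      ((Complex.I • ContinuousLinearMap.id ℂ (Fin n → ℂ)).restrictScalars ℝ))

theorem conjLinearPart_apply (L : (Fin n → ℂ) →L[ℝ] ℂ) (v : Fin n → ℂ) :
    conjLinearPart L v = 1 / 2 * (L v + Complex.I * L (Complex.I • v)) := rfl

theorem ContinuousLinearMap.map_complex_smul (L : (Fin n → ℂ) →L[ℝ] ℂ) (c : ℂ) (v : Fin n → ℂ) :
    L (c • v) = c.re * L v + c.im * L (Complex.I • v) := by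
  have h : c • v = c.re • v + c.im • (Complex.I • v) := by
    ext i
    simp only [Pi.smul_apply, Pi.add_apply, smul_eq_mul, Complex.real_smul]
    linear_combination (-v i) * Complex.re_add_im c
  rw [h, map_add, map_smul, map_smul, Complex.real_smul, Complex.real_smul]

theorem ContinuousLinearMap.map_I_smul_I_smul (L : (Fin n → ℂ) →L[ℝ] ℂ) (v : Fin n → ℂ) :
    L (Complex.I • Complex.I • v) = - L v := by
  rw [smul_smul, Complex.I_mul_I, neg_one_smul, map_neg]

theorem conjLinearPart_smul_apply (L : (Fin n → ℂ) →L[ℝ] ℂ) (c : ℂ) (v : Fin n → ℂ) :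
    conjLinearPart L (c • v) = (starRingEnd ℂ) c * conjLinearPart L v := by
  have hc : (starRingEnd ℂ) c = c.re - c.im * Complex.I := by
    apply Complex.ext <;> simp
  rw [conjLinearPart_apply, conjLinearPart_apply, smul_comm Complex.I c, L.map_complex_smul c v,
    L.map_complex_smul c (Complex.I • v), L.map_I_smul_I_smul, hc]
  linear_combination (1 / 2 * c.im * L (Complex.I • v)) * Complex.I_sq

theorem conjLinearPart_ext {L L' : (Fin n → ℂ) →L[ℝ] ℂ}
    (h : ∀ j, conjLinearPart L (Pi.single j 1) = conjLinearPart L' (Pi.single j 1)) :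
    conjLinearPart L = conjLinearPart L' := by
  ext v
  have hv : v = ∑ j, v j • (Pi.single j 1 : Fin n → ℂ) := pi_eq_sum_univ' v
  rw [hv, map_sum, map_sum]
  exact Finset.sum_congr rfl fun j _ => by
    rw [conjLinearPart_smul_apply, conjLinearPart_smul_apply, h]

/-- A function whose real derivative has no antilinear part is complex differentiable. -/
theorem DifferentiableAt.complex_of_conjLinearPart_eq_zero {u : (Fin n → ℂ) → ℂ} {z : Fin n → ℂ}
    (hu : DifferentiableAt ℝ u z) (h : conjLinearPart (fderiv ℝ u z) = 0) :
    DifferentiableAt ℂ u z := by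
  have hI : ∀ v, fderiv ℝ u z (Complex.I • v) = Complex.I * fderiv ℝ u z v := fun v => by
    have := congrArg (fun L => L v) h
    simp only [conjLinearPart_apply, zero_apply] at this
    linear_combination (-2 * Complex.I) * this + fderiv ℝ u z (Complex.I • v) * Complex.I_sq
  let g' : (Fin n → ℂ) →L[ℂ] ℂ :=
    { toFun := fderiv ℝ u z
      map_add' := map_add _
      map_smul' := fun c v => by
        rw [ContinuousLinearMap.map_complex_smul, hI, RingHom.id_apply, smul_eq_mul]
        linear_combination (fderiv ℝ u z v) * Complex.re_add_im c
      cont := (fderiv ℝ u z).cont }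
  have hg : g'.restrictScalars ℝ = fderiv ℝ u z := by
    ext v
    rfl
  exact (hasFDerivAt_of_restrictScalars ℝ hu.hasFDerivAt hg).differentiableAt

theorem conjLinearPart_fderiv_of_complex {u : (Fin n → ℂ) → ℂ} {z : Fin n → ℂ}
    (hu : DifferentiableAt ℂ u z) : conjLinearPart (fderiv ℝ u z) = 0 := by
  ext v
  rw [conjLinearPart_apply, (hu.hasFDerivAt.restrictScalars ℝ).fderiv]
  simp only [ContinuousLinearMap.coe_restrictScalars', map_smul, smul_eq_mul,
    zero_apply]
  linear_combination (1 / 2 * fderiv ℂ u z v) * Complex.I_sq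

theorem fderiv_conjLinearPart_apply {ω : (Fin n → ℂ) → (Fin n → ℂ) →L[ℝ] ℂ} {z : Fin n → ℂ}
    (hω : DifferentiableAt ℝ ω z) (a b : Fin n → ℂ) :
    fderiv ℝ (fun y => conjLinearPart (ω y) a) z b = conjLinearPart (fderiv ℝ ω z b) a := by
  have h := ((ContinuousLinearMap.apply ℝ ℂ a).comp conjLinearPart).hasFDerivAt.comp z
    hω.hasFDerivAt
  exact congrArg (fun L => L b) h.fderiv

/-- The `∂̄`-derivative of the `(0,1)`-part of a `1`-form `ω` is symmetric, i.e. `∂̄ω^{0,1} = 0`, if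
the exterior derivative of `ω` has no `(0,2)`-part. -/
theorem conjLinearPart_fderiv_conjLinearPart_comm {ω : (Fin n → ℂ) → (Fin n → ℂ) →L[ℝ] ℂ}
    {z : Fin n → ℂ} (hω : DifferentiableAt ℝ ω z)
    (h : ∀ a b, fderiv ℝ ω z (Complex.I • a) (Complex.I • b) -
      fderiv ℝ ω z (Complex.I • b) (Complex.I • a) = fderiv ℝ ω z a b - fderiv ℝ ω z b a)
    (a b : Fin n → ℂ) :
    conjLinearPart (fderiv ℝ (fun y => conjLinearPart (ω y) a) z) b =
      conjLinearPart (fderiv ℝ (fun y => conjLinearPart (ω y) b) z) a := by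
  have key : ∀ a b, conjLinearPart (fderiv ℝ (fun y => conjLinearPart (ω y) a) z) b =
      1 / 2 * (1 / 2 * (fderiv ℝ ω z b a + Complex.I * fderiv ℝ ω z b (Complex.I • a)) +
        Complex.I * (1 / 2 * (fderiv ℝ ω z (Complex.I • b) a +
          Complex.I * fderiv ℝ ω z (Complex.I • b) (Complex.I • a)))) := fun a b => by
    rw [conjLinearPart_apply, fderiv_conjLinearPart_apply hω, fderiv_conjLinearPart_apply hω,
      conjLinearPart_apply, conjLinearPart_apply]
  rw [key, key]
  have h1 := h a b
  have h2 := h a (Complex.I • b)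
  rw [ContinuousLinearMap.map_I_smul_I_smul, smul_smul, Complex.I_mul_I, neg_one_smul, map_neg,
    neg_apply] at h2
  linear_combination (1 / 4 * (fderiv ℝ ω z (Complex.I • b) (Complex.I • a) -
    fderiv ℝ ω z (Complex.I • a) (Complex.I • b))) * Complex.I_sq + (1 / 4) * h1 +
    (1 / 4 * Complex.I) * h2

theorem ContDiffAt.conjLinearPart_fderiv_comm {u : (Fin n → ℂ) → ℂ} {z : Fin n → ℂ}
    (hu : ContDiffAt ℝ 2 u z) (a b : Fin n → ℂ) :
    conjLinearPart (fderiv ℝ (fun y => conjLinearPart (fderiv ℝ u y) a) z) b =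
      conjLinearPart (fderiv ℝ (fun y => conjLinearPart (fderiv ℝ u y) b) z) a := by
  have hsymm : IsSymmSndFDerivAt ℝ u z := hu.isSymmSndFDerivAt (by simp)
  refine conjLinearPart_fderiv_conjLinearPart_comm
    ((hu.fderiv_right (m := 1) (by norm_num)).differentiableAt one_ne_zero) (fun a b => ?_) a b
  rw [hsymm.eq a b, hsymm.eq (Complex.I • a)]
  simp

end ConjLinearPart

/-! ### Cauchy transforms in one of several variables -/

section Dolbeault

open MeasureTheory Set Metric Convolution

variable {n : ℕ}

/-- The fundamental solution `1 / (π w)` of the operator `∂/∂w̄` on `ℂ`. -/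
noncomputable def cauchyKernel (w : ℂ) : ℂ := (Real.pi * w)⁻¹

theorem locallyIntegrable_cauchyKernel : LocallyIntegrable cauchyKernel := by
  refine locallyIntegrable_of_norm_le_rpow (C := Real.pi⁻¹) (α := 1) (by simp) (by simp)
    (Filter.Eventually.of_forall fun w => ?_) (by unfold cauchyKernel; fun_prop)
  rw [cauchyKernel, mul_inv, norm_mul, norm_inv, norm_inv, Real.rpow_neg_one, Complex.norm_real,
    Real.norm_of_nonneg Real.pi_pos.le]

/-- Convolution with the Cauchy kernel along the direction `e` of `ℂⁿ`. -/
noncomputable def cauchyTransform (e : Fin n → ℂ) (h : (Fin n → ℂ) → ℂ) (p : Fin n → ℂ) : ℂ :=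
  ∫ w, cauchyKernel w * h (p - w • e)

variable {e : Fin n → ℂ} {h : (Fin n → ℂ) → ℂ} {s W : Set (Fin n → ℂ)} {k : Set ℂ}

theorem cauchyTransform_eq_convolution (p : Fin n → ℂ) :
    cauchyTransform e h p =
      (cauchyKernel ⋆[ContinuousLinearMap.mul ℝ ℂ, volume] fun x => h (p + x • e)) 0 := by
  simp [cauchyTransform, convolution_def, sub_eq_add_neg]

theorem contDiffOn_line {m : ℕ∞} (hh : ContDiffOn ℝ m h W)
    (hsW : ∀ p ∈ s, ∀ x : ℂ, p + x • e ∈ W) :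
    ContDiffOn ℝ m (↿fun (p : Fin n → ℂ) (x : ℂ) => h (p + x • e)) (s ×ˢ univ) :=
  hh.comp (f := fun q : (Fin n → ℂ) × ℂ => q.1 + q.2 • e)
    (contDiff_fst.add (contDiff_snd.smul contDiff_const)).contDiffOn fun q hq => hsW q.1 hq.1 q.2

theorem contDiffOn_cauchyTransform (hs : IsOpen s) (hk : IsCompact k)
    (hh : ContDiffOn ℝ ((⊤ : ℕ∞) : WithTop ℕ∞) h W) (hsW : ∀ p ∈ s, ∀ x : ℂ, p + x • e ∈ W)
    (h0 : ∀ p ∈ s, ∀ x ∉ k, h (p + x • e) = 0) :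
    ContDiffOn ℝ ((⊤ : ℕ∞) : WithTop ℕ∞) (cauchyTransform e h) s :=
  (contDiffOn_convolution_right_with_param_comp (ContinuousLinearMap.mul ℝ ℂ)
    (contDiffOn_const (c := (0 : ℂ))) hs hk (fun p x hp hx => h0 p hp x hx)
    locallyIntegrable_cauchyKernel (contDiffOn_line hh hsW)).congr
    fun p _ => cauchyTransform_eq_convolution p

/-- Derivatives of a Cauchy transform are computed under the integral sign. -/
theorem conjLinearPart_fderiv_cauchyTransform (hs : IsOpen s) (hk : IsCompact k) (hW : IsOpen W)
    (hh : ContDiffOn ℝ 1 h W) (hsW : ∀ p ∈ s, ∀ x : ℂ, p + x • e ∈ W)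
    (h0 : ∀ p ∈ s, ∀ x ∉ k, h (p + x • e) = 0) {p : Fin n → ℂ} (hp : p ∈ s) (a : Fin n → ℂ) :
    conjLinearPart (fderiv ℝ (cauchyTransform e h) p) a =
      ∫ w, cauchyKernel w * conjLinearPart (fderiv ℝ h (p - w • e)) a := by
  let g : (Fin n → ℂ) → ℂ → ℂ := fun p x => h (p + x • e)
  have hd : ∀ q ∈ W, HasFDerivAt h (fderiv ℝ h q) q := fun q hq =>
    ((hh.contDiffAt (hW.mem_nhds hq)).differentiableAt one_ne_zero).hasFDerivAt
  -- The derivative of `h` along the affine line through `p` has compact support.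
  have hDc : ∀ a, Continuous fun x : ℂ => fderiv ℝ h (p + x • e) a := fun a =>
    ((hh.continuousOn_fderiv_of_isOpen hW le_rfl).comp_continuous (by fun_prop)
      (hsW p hp)).clm_apply continuous_const
  have hDs : ∀ x ∉ k, fderiv ℝ h (p + x • e) = 0 := by
    intro x hx
    have hnear : h =ᶠ[nhds (p + x • e)] fun _ => 0 := by
      have hcont : ContinuousAt (fun q => q - x • e) (p + x • e) := by fun_prop
      have hmem := hcont.preimage_mem_nhds (hs.mem_nhds (by simpa using hp))
      filter_upwards [hmem] with q hq
      simpa using h0 _ hq x hx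
    rw [hnear.fderiv_eq, fderiv_fun_const]
    rfl
  have hDcs : ∀ a, HasCompactSupport fun x : ℂ => fderiv ℝ h (p + x • e) a := fun a =>
    HasCompactSupport.intro hk fun x hx => by rw [hDs x hx, zero_apply]
  have hint : ∀ a, Integrable fun w => cauchyKernel w * fderiv ℝ h (p - w • e) a := fun a => by
    have := (hDcs a).convolutionExists_right (ContinuousLinearMap.mul ℝ ℂ)
      locallyIntegrable_cauchyKernel (hDc a) 0
    simpa [ConvolutionExistsAt, sub_eq_add_neg] using this
  -- Differentiation under the integral sign.
  have hg1 := contDiffOn_line (m := 1) hh hsW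
  have hgd : ∀ x, HasFDerivAt (↿g) ((fderiv ℝ h (p + x • e)).comp
      (ContinuousLinearMap.fst ℝ _ _ + (ContinuousLinearMap.snd ℝ _ ℂ).smulRight e)) (p, x) :=
    fun x => (hd _ (hsW p hp x)).comp (p, x) (f := fun q : (Fin n → ℂ) × ℂ => q.1 + q.2 • e)
      (hasFDerivAt_fst.add (hasFDerivAt_snd.smul_const e))
  have hfd : (fun x => fderiv ℝ (↿g) (p, x)) = fun x => (fderiv ℝ h (p + x • e)).comp
      (ContinuousLinearMap.fst ℝ _ _ + (ContinuousLinearMap.snd ℝ _ ℂ).smulRight e) :=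
    funext fun x => (hgd x).fderiv
  have hconv := hasFDerivAt_convolution_right_with_param (ContinuousLinearMap.mul ℝ ℂ) hs hk
    (fun p x hp hx => h0 p hp x hx) locallyIntegrable_cauchyKernel hg1 (p, 0) hp
  have hconv' := hconv.comp p (f := fun p => (p, (0 : ℂ))) (hasFDerivAt_prodMk_left p 0)
  have hderiv : ∀ a, fderiv ℝ (cauchyTransform e h) p a =
      ∫ w, cauchyKernel w * fderiv ℝ h (p - w • e) a := by
    intro a
    have heq : cauchyTransform e h = (fun q : (Fin n → ℂ) × ℂ =>
        (cauchyKernel ⋆[ContinuousLinearMap.mul ℝ ℂ, volume] fun x => h (q.1 + x • e)) q.2) ∘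
          fun p => (p, 0) := funext fun p => cauchyTransform_eq_convolution p
    rw [heq, hconv'.fderiv, ContinuousLinearMap.comp_apply, hfd, convolution_precompR_apply]
    · simp [convolution_def, sub_eq_add_neg]
    · exact locallyIntegrable_cauchyKernel
    · exact HasCompactSupport.intro hk fun x hx => by rw [hDs x hx, ContinuousLinearMap.zero_comp]
    · exact ((hh.continuousOn_fderiv_of_isOpen hW le_rfl).comp_continuous (by fun_prop)
        (hsW p hp)).clm_comp continuous_const
  rw [conjLinearPart_apply, hderiv, hderiv, ← integral_const_mul, ← integral_add (hint a)
    ((hint _).const_mul _), ← integral_const_mul]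
  refine integral_congr_ae (Filter.Eventually.of_forall fun w => ?_)
  simp only [conjLinearPart_apply]
  ring

end Dolbeault

/-! ### The `∂̄`-Poincaré lemma -/

section Dolbeault

open MeasureTheory Set Metric

variable {n : ℕ}

/-- The Cauchy transform inverts `∂̄` in one dimension. -/
theorem integral_cauchyKernel_mul_dbar {g : ℂ → ℂ} (hg : ContDiff ℝ 1 g)
    (hc : HasCompactSupport g) :
    ∫ w, cauchyKernel w * (1 / 2 * (fderiv ℝ g (-w) 1 + Complex.I * fderiv ℝ g (-w) Complex.I)) =
      g 0 := by
  rw [← integral_neg_eq_self]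
  have h : ∀ w, cauchyKernel (-w) * (1 / 2 * (fderiv ℝ g (- -w) 1 +
      Complex.I * fderiv ℝ g (- -w) Complex.I)) = (-(Real.pi : ℂ)⁻¹) *
        (w⁻¹ * (1 / 2 * (fderiv ℝ g w 1 + Complex.I * fderiv ℝ g w Complex.I))) := fun w => by
    rw [neg_neg, cauchyKernel, mul_neg, inv_neg, mul_inv]
    ring
  simp only [h]
  rw [integral_const_mul, integral_inv_mul_dbar_eq hg hc]
  have : (Real.pi : ℂ) ≠ 0 := by exact_mod_cast Real.pi_ne_zero
  field_simp

theorem mem_polydisc_iff {z₀ z : Fin n → ℂ} {r : ℝ} (hr : 0 < r) :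
    z ∈ ball z₀ r ↔ ∀ j, z j ∈ ball (z₀ j) r := by
  rw [mem_ball, dist_pi_lt_iff hr]
  rfl

/-- Solution of the equation `∂v/∂z̄ₖ = f` on a smaller polydisc. The solution, a Cauchy transform
in the variable `zₖ`, is holomorphic in every other variable in which `f` is holomorphic. -/
theorem exists_conjLinearPart_fderiv_single_eq {z₀ : Fin n → ℂ} {r : ℝ} (hr : 0 < r) (k : Fin n)
    {f : (Fin n → ℂ) → ℂ} (hf : ContDiffOn ℝ ((⊤ : ℕ∞) : WithTop ℕ∞) f (ball z₀ r)) :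
    ∃ v : (Fin n → ℂ) → ℂ, ContDiffOn ℝ ((⊤ : ℕ∞) : WithTop ℕ∞) v (ball z₀ r) ∧
      (∀ z ∈ ball z₀ (r / 2), conjLinearPart (fderiv ℝ v z) (Pi.single k 1) = f z) ∧
      ∀ j ≠ k, (∀ z ∈ ball z₀ r, conjLinearPart (fderiv ℝ f z) (Pi.single j 1) = 0) →
        ∀ z ∈ ball z₀ r, conjLinearPart (fderiv ℝ v z) (Pi.single j 1) = 0 := by
  let χ : ContDiffBump (z₀ k) := ⟨r / 2, 3 * r / 4, by positivity, by linarith⟩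
  let e : Fin n → ℂ := Pi.single k 1
  have he : ∀ (p : Fin n → ℂ) (x : ℂ), (p + x • e) k = p k + x := fun p x => by simp [e]
  have he' : ∀ (p : Fin n → ℂ) (x : ℂ), ∀ j ≠ k, (p + x • e) j = p j := fun p x j hj => by
    simp [e, hj]
  -- `h` is smooth on a set which contains all lines in the direction `e` meeting the polydisc.
  let h : (Fin n → ℂ) → ℂ := fun z => (χ (z k) : ℂ) * f z
  let W : Set (Fin n → ℂ) := {z | ∀ j ≠ k, z j ∈ ball (z₀ j) r}
  have hW : IsOpen W := by
    have : W = ⋂ j, ⋂ (_ : j ≠ k), (fun z : Fin n → ℂ => z j) ⁻¹' ball (z₀ j) r := by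
      ext z
      simp [W]
    rw [this]
    exact isOpen_iInter_of_finite fun j => isOpen_iInter_of_finite fun _ =>
      isOpen_ball.preimage (continuous_apply j)
  have hball : ∀ z ∈ W, z k ∈ ball (z₀ k) r → z ∈ ball z₀ r := fun z hz hzk =>
    (mem_polydisc_iff hr).2 fun j => by
      by_cases hj : j = k
      · exact hj ▸ hzk
      · exact hz j hj
  have hfar : ∀ z : Fin n → ℂ, z k ∉ ball (z₀ k) r → h =ᶠ[nhds z] 0 := by
    intro z hz
    have hopen : IsOpen ((fun z : Fin n → ℂ => z k) ⁻¹' (closedBall (z₀ k) (3 * r / 4))ᶜ) :=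
      isClosed_closedBall.isOpen_compl.preimage (continuous_apply k)
    filter_upwards [hopen.mem_nhds (x := z) fun hz' => hz
      (closedBall_subset_ball (by linarith) hz')] with y hy
    have : χ (y k) = 0 := χ.zero_of_le_dist (le_of_lt (not_le.1 hy))
    simp [h, this]
  have hχ : ContDiff ℝ ((⊤ : ℕ∞) : WithTop ℕ∞) fun z : Fin n → ℂ => (χ (z k) : ℂ) :=
    Complex.ofRealCLM.contDiff.comp (χ.contDiff.comp (contDiff_apply ℝ ℂ k))
  have hh : ContDiffOn ℝ ((⊤ : ℕ∞) : WithTop ℕ∞) h W := by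
    intro z hz
    by_cases hzk : z k ∈ ball (z₀ k) r
    · exact (hχ.contDiffAt.mul
        (hf.contDiffAt (isOpen_ball.mem_nhds (hball z hz hzk)))).contDiffWithinAt
    · exact (contDiffAt_const.congr_of_eventuallyEq (hfar z hzk)).contDiffWithinAt
  have hsW : ∀ p ∈ ball z₀ r, ∀ x : ℂ, p + x • e ∈ W := fun p hp x j hj => by
    rw [he' p x j hj]
    exact (mem_polydisc_iff hr).1 hp j
  have h0 : ∀ p ∈ ball z₀ r, ∀ x ∉ closedBall (0 : ℂ) (2 * r), h (p + x • e) = 0 := by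
    intro p hp x hx
    refine (hfar _ fun hx' => hx ?_).self_of_nhds
    have h1 := mem_ball_iff_norm.1 ((mem_polydisc_iff hr).1 hp k)
    rw [he, mem_ball_iff_norm] at hx'
    have h2 := norm_sub_le (p k + x - z₀ k) (p k - z₀ k)
    rw [show p k + x - z₀ k - (p k - z₀ k) = x by ring] at h2
    rw [mem_closedBall_zero_iff]
    linarith
  have hk := isCompact_closedBall (0 : ℂ) (2 * r)
  have hh1 : ContDiffOn ℝ 1 h W := hh.of_le (by exact_mod_cast le_top)
  refine ⟨cauchyTransform e h, contDiffOn_cauchyTransform isOpen_ball hk hh hsW h0, ?_, ?_⟩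
  · intro p hp
    have hp' : p ∈ ball z₀ r := ball_subset_ball (by linarith) hp
    rw [conjLinearPart_fderiv_cauchyTransform isOpen_ball hk hW hh1 hsW h0 hp']
    let g : ℂ → ℂ := fun x => h (p + x • e)
    have hg : ContDiff ℝ 1 g := contDiffOn_univ.1
      (hh1.comp (f := fun x : ℂ => p + x • e) (by fun_prop) fun x _ => hsW p hp' x)
    have hgc : HasCompactSupport g := HasCompactSupport.intro hk (h0 p hp')
    have hgd : ∀ x y : ℂ, fderiv ℝ g x y = fderiv ℝ h (p + x • e) (y • e) := by
      intro x y
      have h1 : HasFDerivAt (fun x : ℂ => p + x • e)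
          ((ContinuousLinearMap.id ℝ ℂ).smulRight e) x :=
        ((hasFDerivAt_id (𝕜 := ℝ) x).smul_const e).const_add p
      have h2 := (((hh1.contDiffAt (hW.mem_nhds (hsW p hp' x))).differentiableAt
        one_ne_zero).hasFDerivAt.comp x h1).fderiv
      exact congrArg (fun L => L y) h2
    have hval : f p = g 0 := by
      have : χ (p k) = 1 := χ.one_of_mem_closedBall
        (ball_subset_closedBall ((mem_polydisc_iff (by positivity)).1 hp k))
      simp [g, h, this]
    rw [hval, ← integral_cauchyKernel_mul_dbar hg hgc]
    refine integral_congr_ae (Filter.Eventually.of_forall fun w => ?_)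
    simp only [conjLinearPart_apply, hgd, one_smul, neg_smul, sub_eq_add_neg]
    rfl
  · intro j hj hfj p hp
    rw [conjLinearPart_fderiv_cauchyTransform isOpen_ball hk hW hh1 hsW h0 hp]
    refine (integral_congr_ae (Filter.Eventually.of_forall fun w => ?_)).trans
      (integral_zero ℂ ℂ)
    have hq : p - w • e ∈ W := by simpa [sub_eq_add_neg] using hsW p hp (-w)
    set q := p - w • e
    by_cases hqk : q k ∈ ball (z₀ k) r
    · have hqb := hball q hq hqk
      have hdf := (hf.contDiffAt (isOpen_ball.mem_nhds hqb)).differentiableAt (by simp)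
      have hχd : HasFDerivAt (fun z : Fin n → ℂ => (χ (z k) : ℂ))
          (Complex.ofRealCLM.comp ((fderiv ℝ χ (q k)).comp (ContinuousLinearMap.proj k))) q :=
        Complex.ofRealCLM.hasFDerivAt.comp q
          (((χ.contDiff (n := 1)).differentiable one_ne_zero _).hasFDerivAt.comp q
            (hasFDerivAt_apply k q))
      have hd : fderiv ℝ h q = _ := (hχd.mul hdf.hasFDerivAt).fderiv
      have := hfj q hqb
      simp only [conjLinearPart_apply] at this
      simp only [hd, conjLinearPart_apply]
      have hjk : (Pi.single j (1 : ℂ) : Fin n → ℂ) k = 0 := by simp [hj.symm]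
      simp only [add_apply, smul_apply, ContinuousLinearMap.comp_apply,
        ContinuousLinearMap.proj_apply, Pi.smul_apply, hjk, smul_eq_mul, mul_zero,
        map_zero]
      linear_combination (2 * cauchyKernel w * (χ (q k) : ℂ) * (1 / 2)) * this
    · simp [(hfar q hqk).fderiv_eq]

/-- Coordinate form of the `∂̄`-Poincaré lemma in bidegree `(0,1)`, by induction on the number `k` of
differentials `dz̄ⱼ` occurring in the form `∑ fⱼ dz̄ⱼ`: since the form is closed, its last coefficient
is holomorphic in the variables whose differentials do not occur, and so is the Cauchy transform
which removes that coefficient. -/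
theorem exists_conjLinearPart_fderiv_eq_of_vanishing (z₀ : Fin n → ℂ) (k : ℕ) {r : ℝ} (hr : 0 < r)
    {f : Fin n → (Fin n → ℂ) → ℂ}
    (hf : ∀ j, ContDiffOn ℝ ((⊤ : ℕ∞) : WithTop ℕ∞) (f j) (ball z₀ r))
    (hclosed : ∀ i j, ∀ z ∈ ball z₀ r, conjLinearPart (fderiv ℝ (f i) z) (Pi.single j 1) =
      conjLinearPart (fderiv ℝ (f j) z) (Pi.single i 1))
    (hzero : ∀ j : Fin n, k ≤ j → ∀ z ∈ ball z₀ r, f j z = 0) :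
    ∃ u : (Fin n → ℂ) → ℂ, ∃ ρ > 0, ρ ≤ r ∧
      ContDiffOn ℝ ((⊤ : ℕ∞) : WithTop ℕ∞) u (ball z₀ ρ) ∧
      ∀ z ∈ ball z₀ ρ, ∀ j, conjLinearPart (fderiv ℝ u z) (Pi.single j 1) = f j z := by
  induction k generalizing r f with
  | zero =>
    refine ⟨0, r, hr, le_rfl, contDiffOn_const, fun z hz j => ?_⟩
    simp [hzero j (Nat.zero_le _) z hz]
  | succ k ih =>
    by_cases hkn : k < n
    swap
    · exact ih hr hf hclosed fun j hj => absurd j.2 (by omega)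
    obtain ⟨v, hv, hvk, hvj⟩ := exists_conjLinearPart_fderiv_single_eq hr ⟨k, hkn⟩ (hf ⟨k, hkn⟩)
    have hsub : ball z₀ (r / 2) ⊆ ball z₀ r := ball_subset_ball (by linarith)
    have hvd : ∀ z ∈ ball z₀ r, ContDiffAt ℝ ((⊤ : ℕ∞) : WithTop ℕ∞) v z := fun z hz =>
      hv.contDiffAt (isOpen_ball.mem_nhds hz)
    let g : Fin n → (Fin n → ℂ) → ℂ := fun j z => conjLinearPart (fderiv ℝ v z) (Pi.single j 1)
    have hg : ∀ j, ContDiffOn ℝ ((⊤ : ℕ∞) : WithTop ℕ∞) (g j) (ball z₀ r) := fun j =>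
      ((ContinuousLinearMap.apply ℝ ℂ (Pi.single j 1)).comp conjLinearPart).contDiff.comp_contDiffOn
        (hv.fderiv_of_isOpen isOpen_ball (by simp))
    have hda : ∀ {a : (Fin n → ℂ) → ℂ}, ContDiffOn ℝ ((⊤ : ℕ∞) : WithTop ℕ∞) a (ball z₀ r) →
        ∀ z ∈ ball z₀ r, DifferentiableAt ℝ a z := fun ha z hz =>
      (ha.contDiffAt (isOpen_ball.mem_nhds hz)).differentiableAt (by simp)
    obtain ⟨u, ρ, hρ, hρr, hu, huf⟩ := ih (r := r / 2) (f := fun j => f j - g j) (by positivity)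
      (fun j => ((hf j).sub (hg j)).mono hsub)
      (fun i j z hz => by
        have hz' := hsub hz
        rw [fderiv_sub (hda (hf i) z hz') (hda (hg i) z hz'),
          fderiv_sub (hda (hf j) z hz') (hda (hg j) z hz'), map_sub, map_sub, sub_apply, sub_apply,
          hclosed i j z hz']
        congr 1
        exact ((hvd z hz').of_le (WithTop.coe_le_coe.2 le_top)).conjLinearPart_fderiv_comm _ _)
      (fun j hj z hz => by
        rw [Pi.sub_apply, sub_eq_zero]
        rcases hj.eq_or_lt with hj | hj
        · obtain rfl : (⟨k, hkn⟩ : Fin n) = j := Fin.ext hj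
          exact (hvk z hz).symm
        · rw [hzero j hj z (hsub hz)]
          refine (hvj j (fun h => by simp [h] at hj) (fun y hy => ?_) z (hsub hz)).symm
          have hfj : f j =ᶠ[nhds y] 0 := by
            filter_upwards [isOpen_ball.mem_nhds hy] with x hx
            exact hzero j hj x hx
          rw [hclosed _ j y hy, hfj.fderiv_eq]
          simp)
    refine ⟨u + v, ρ, hρ, by linarith, hu.add (hv.mono (ball_subset_ball (by linarith))),
      fun z hz j => ?_⟩
    have hz' : z ∈ ball z₀ r := ball_subset_ball (by linarith) hz
    rw [fderiv_add ((hu.contDiffAt (isOpen_ball.mem_nhds hz)).differentiableAt (by simp))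
      (hda hv z hz'), map_add, add_apply, huf z hz j]
    simp [g]

/-- The **`∂̄`-Poincaré lemma** in bidegree `(0,1)`: the `(0,1)`-part of a smooth `1`-form `ω` is
locally of the form `∂̄u` if `dω` has no `(0,2)`-part. -/
theorem exists_conjLinearPart_fderiv_eq {ω : (Fin n → ℂ) → (Fin n → ℂ) →L[ℝ] ℂ}
    {U : Set (Fin n → ℂ)} (hU : IsOpen U) (hω : ContDiffOn ℝ ((⊤ : ℕ∞) : WithTop ℕ∞) ω U)
    (h : ∀ z ∈ U, ∀ a b, fderiv ℝ ω z (Complex.I • a) (Complex.I • b) -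
      fderiv ℝ ω z (Complex.I • b) (Complex.I • a) = fderiv ℝ ω z a b - fderiv ℝ ω z b a)
    {z₀ : Fin n → ℂ} (hz₀ : z₀ ∈ U) :
    ∃ u : (Fin n → ℂ) → ℂ, ∃ W ⊆ U, IsOpen W ∧ z₀ ∈ W ∧
      ContDiffOn ℝ ((⊤ : ℕ∞) : WithTop ℕ∞) u W ∧
      ∀ z ∈ W, conjLinearPart (fderiv ℝ u z) = conjLinearPart (ω z) := by
  obtain ⟨r, hr, hrU⟩ := Metric.isOpen_iff.1 hU z₀ hz₀
  obtain ⟨u, ρ, hρ, hρr, hu, huf⟩ := exists_conjLinearPart_fderiv_eq_of_vanishing z₀ n hr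
    (f := fun j z => conjLinearPart (ω z) (Pi.single j 1))
    (fun j => ((ContinuousLinearMap.apply ℝ ℂ (Pi.single j 1)).comp
      conjLinearPart).contDiff.comp_contDiffOn (hω.mono hrU))
    (fun i j z hz => conjLinearPart_fderiv_conjLinearPart_comm
      ((hω.contDiffAt (hU.mem_nhds (hrU hz))).differentiableAt (by simp)) (h z (hrU hz)) _ _)
    (fun j hj => absurd j.2 (by omega))
  exact ⟨u, ball z₀ ρ, (ball_subset_ball hρr).trans hrU, isOpen_ball, mem_ball_self hρ, hu,
    fun z hz => conjLinearPart_ext (huf z hz)⟩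

end Dolbeault

/-! ### From local to global solutions on an orbifold -/

section Orbifold

open Set

variable {n : ℕ} {X : Type u} [TopologicalSpace X]

/-- The action of a group element as a biholomorphic map of the chart domain. -/
def OrbifoldChart.actHomeomorph (c : OrbifoldChart.{u, w} n X) (g : c.Γ) :
    OpenPartialHomeomorph (Fin n → ℂ) (Fin n → ℂ) where
  toFun := c.act g
  invFun := c.act g⁻¹
  source := c.dom
  target := c.dom
  map_source' z hz := c.act_mapsTo g hz
  map_target' z hz := c.act_mapsTo g⁻¹ hz
  left_inv' z hz := by rw [← c.act_mul _ _ z hz, inv_mul_cancel, c.act_one z hz]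
  right_inv' z hz := by rw [← c.act_mul _ _ z hz, mul_inv_cancel, c.act_one z hz]
  open_source := c.isOpen_dom
  open_target := c.isOpen_dom
  continuousOn_toFun := (c.act_holomorphic g).continuousOn
  continuousOn_invFun := (c.act_holomorphic g⁻¹).continuousOn

theorem OrbifoldChart.isChangeOfCharts_actHomeomorph (c : OrbifoldChart.{u, w} n X) (g : c.Γ) :
    IsChangeOfCharts c c (c.actHomeomorph g) where
  source_subset := Subset.rfl
  target_subset := Subset.rfl
  holomorphic := c.act_holomorphic g
  holomorphic_symm := c.act_holomorphic g⁻¹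
  proj_apply z hz := ((c.proj_eq_iff z hz _ (c.act_mapsTo g hz)).2 ⟨g, rfl⟩).symm

theorem IsChangeOfCharts.differentiableAt {c c' : OrbifoldChart.{u, w} n X}
    {φ : OpenPartialHomeomorph (Fin n → ℂ) (Fin n → ℂ)} (hφ : IsChangeOfCharts c c' φ)
    {z : Fin n → ℂ} (hz : z ∈ φ.source) : DifferentiableAt ℂ φ z :=
  hφ.holomorphic.differentiableAt (φ.open_source.mem_nhds hz)

theorem IsChangeOfCharts.contDiffAt {c c' : OrbifoldChart.{u, w} n X}
    {φ : OpenPartialHomeomorph (Fin n → ℂ) (Fin n → ℂ)} (hφ : IsChangeOfCharts c c' φ)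
    {z : Fin n → ℂ} (hz : z ∈ φ.source) : ContDiffAt ℝ ((⊤ : ℕ∞) : WithTop ℕ∞) φ z :=
  contDiffAt_pi.2 fun j => (((differentiableOn_pi.1 hφ.holomorphic j).contDiffOn_of_complex
    φ.open_source).contDiffAt (φ.open_source.mem_nhds hz)).restrict_scalars ℝ

namespace ComplexOrbifold

variable (M : ComplexOrbifold.{u, v, w} n X)

/-- A family of `ℝ`-linear `1`-forms on the chart domains is compatible if its members are pulled
back to each other by all changes of charts. -/
def IsCompatibleFamily (θ : M.ι → (Fin n → ℂ) → (Fin n → ℂ) →L[ℝ] ℂ) : Prop :=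
  ∀ i j φ, IsChangeOfCharts (M.chart i) (M.chart j) φ → ∀ z ∈ φ.source,
    (θ j (φ z)).comp (fderiv ℝ φ z) = θ i z

/-- Let `A` be an operator on `ℝ`-linear forms, for instance the identity or the projection to the
antilinear part. A function `s` is a smooth solution of `A (ds) = θ` on the set `U` if it is so in
all charts. -/
def IsSolution (A : ((Fin n → ℂ) →L[ℝ] ℂ) →L[ℝ] ((Fin n → ℂ) →L[ℝ] ℂ))
    (θ : M.ι → (Fin n → ℂ) → (Fin n → ℂ) →L[ℝ] ℂ) (U : Set X) (s : X → ℂ) : Prop :=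
  ∀ i, ∀ z ∈ (M.chart i).dom, (M.chart i).proj z ∈ U →
    ContDiffAt ℝ ((⊤ : ℕ∞) : WithTop ℕ∞) (fun y => s ((M.chart i).proj y)) z ∧
      A (fderiv ℝ (fun y => s ((M.chart i).proj y)) z) = θ i z

variable {M}
variable {A : ((Fin n → ℂ) →L[ℝ] ℂ) →L[ℝ] ((Fin n → ℂ) →L[ℝ] ℂ)}
  {θ : M.ι → (Fin n → ℂ) → (Fin n → ℂ) →L[ℝ] ℂ}

/-- Solutions of `A (du) = θ` are pulled back to solutions by changes of charts, provided that `A`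
commutes with the composition with `ℂ`-linear maps. -/
theorem IsCompatibleFamily.solution_comp (hθ : M.IsCompatibleFamily θ)
    (hA : ∀ L (T : (Fin n → ℂ) →L[ℂ] (Fin n → ℂ)),
      A (L.comp (T.restrictScalars ℝ)) = (A L).comp (T.restrictScalars ℝ))
    {i j : M.ι} {φ : OpenPartialHomeomorph (Fin n → ℂ) (Fin n → ℂ)}
    (hφ : IsChangeOfCharts (M.chart i) (M.chart j) φ) {z : Fin n → ℂ} (hz : z ∈ φ.source)
    {u : (Fin n → ℂ) → ℂ} (hu : ContDiffAt ℝ ((⊤ : ℕ∞) : WithTop ℕ∞) u (φ z))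
    (hAu : A (fderiv ℝ u (φ z)) = θ j (φ z)) :
    ContDiffAt ℝ ((⊤ : ℕ∞) : WithTop ℕ∞) (fun y => u (φ y)) z ∧
      A (fderiv ℝ (fun y => u (φ y)) z) = θ i z := by
  refine ⟨hu.comp z (hφ.contDiffAt hz), ?_⟩
  have hd : HasFDerivAt φ ((fderiv ℂ φ z).restrictScalars ℝ) z :=
    (hφ.differentiableAt hz).hasFDerivAt.restrictScalars ℝ
  have h : fderiv ℝ (fun y => u (φ y)) z = _ :=
    ((hu.differentiableAt (by simp)).hasFDerivAt.comp z hd).fderiv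
  rw [h, hA, hAu, ← hθ i j φ hφ z hz, hd.fderiv]

/-- If the equation `A (du) = θ` has local solutions on the chart domains, then it has local
solutions on the orbifold: the average of a solution over the stabilizer of a point descends to a
neighbourhood of the image of the point. -/
theorem IsCompatibleFamily.exists_isSolution_nhds (hθ : M.IsCompatibleFamily θ)
    (hA : ∀ L (T : (Fin n → ℂ) →L[ℂ] (Fin n → ℂ)),
      A (L.comp (T.restrictScalars ℝ)) = (A L).comp (T.restrictScalars ℝ))
    (hloc : ∀ i, ∀ z ∈ (M.chart i).dom, ∃ u : (Fin n → ℂ) → ℂ, ∃ W ⊆ (M.chart i).dom,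
      IsOpen W ∧ z ∈ W ∧ ContDiffOn ℝ ((⊤ : ℕ∞) : WithTop ℕ∞) u W ∧
        ∀ y ∈ W, A (fderiv ℝ u y) = θ i y) (x : X) :
    ∃ U : Opens X, x ∈ U ∧ ∃ s : X → ℂ, M.IsSolution A θ U s := by
  classical
  obtain ⟨i, z, hz, rfl⟩ := M.covers x
  obtain ⟨u, W, hWdom, hW, hzW, hu, hAu⟩ := hloc i z hz
  set c := M.chart i with hc
  have : Fintype c.Γ := Fintype.ofFinite _
  have hcont : ∀ g, ContinuousAt (c.act g) z := fun g =>
    (c.act_holomorphic g).continuousOn.continuousAt (c.isOpen_dom.mem_nhds hz)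
  -- A neighbourhood of `z` which is mapped into `W` by the stabilizer of `z`, and in which only
  -- elements of the stabilizer identify points.
  have hN : ∀ g, ∃ N ∈ nhds z, (c.act g z = z → ∀ y ∈ N, c.act g y ∈ W) ∧
      (c.act g z ≠ z → ∀ y ∈ N, c.act g y ∉ N) := by
    intro g
    by_cases hg : c.act g z = z
    · exact ⟨_, (hcont g).preimage_mem_nhds (by rw [hg]; exact hW.mem_nhds hzW),
        fun _ y hy => hy, fun h => absurd hg h⟩
    · obtain ⟨S, T, hS, hT, hgS, hzT, hST⟩ := t2_separation hg
      exact ⟨c.act g ⁻¹' S ∩ T, Filter.inter_mem ((hcont g).preimage_mem_nhds (hS.mem_nhds hgS))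
        (hT.mem_nhds hzT), fun h => absurd h hg,
        fun _ y hy hy' => hST.le_bot ⟨hy.1, hy'.2⟩⟩
  choose N hNz hN1 hN2 using hN
  obtain ⟨W', hW'sub, hW', hzW'⟩ : ∃ W' ⊆ W ∩ ⋂ g, N g, IsOpen W' ∧ z ∈ W' :=
    mem_nhds_iff.1 (Filter.inter_mem (hW.mem_nhds hzW) (Filter.iInter_mem.2 hNz))
  have hW'N : ∀ y ∈ W', ∀ g, y ∈ N g := fun y hy => mem_iInter.1 (hW'sub hy).2
  have hW'dom : W' ⊆ c.dom := fun y hy => hWdom (hW'sub hy).1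
  -- The average of `u` over the stabilizer.
  let S : Finset c.Γ := Finset.univ.filter fun g => c.act g z = z
  have hScard : ((S.card : ℕ) : ℝ) ≠ 0 := by
    have : (1 : c.Γ) ∈ S := by simp [S, c.act_one z hz]
    exact_mod_cast (Finset.card_pos.2 ⟨_, this⟩).ne'
  let uAvg : (Fin n → ℂ) → ℂ := fun y => (S.card : ℝ)⁻¹ • ∑ g ∈ S, u (c.act g y)
  have hpiece : ∀ y ∈ W', ∀ g ∈ S, ContDiffAt ℝ ((⊤ : ℕ∞) : WithTop ℕ∞) (fun y => u (c.act g y)) y ∧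
      A (fderiv ℝ (fun y => u (c.act g y)) y) = θ i y := by
    intro y hy g hg
    have hgy : c.act g y ∈ W := hN1 g (Finset.mem_filter.1 hg).2 y (hW'N y hy g)
    exact hθ.solution_comp hA (c.isChangeOfCharts_actHomeomorph g) (hW'dom hy)
      (hu.contDiffAt (hW.mem_nhds hgy)) (hAu _ hgy)
  have huAvg : ∀ y ∈ W', ContDiffAt ℝ ((⊤ : ℕ∞) : WithTop ℕ∞) uAvg y ∧ A (fderiv ℝ uAvg y) = θ i y := by
    intro y hy
    refine ⟨(ContDiffAt.sum fun g hg => (hpiece y hy g hg).1).const_smul _, ?_⟩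
    have hd : HasFDerivAt uAvg ((S.card : ℝ)⁻¹ • ∑ g ∈ S, fderiv ℝ (fun y => u (c.act g y)) y) y :=
      (HasFDerivAt.fun_sum fun g hg =>
        ((hpiece y hy g hg).1.differentiableAt (by simp)).hasFDerivAt).fun_const_smul _
    rw [hd.fderiv, map_smul, map_sum, Finset.sum_congr rfl fun g hg => (hpiece y hy g hg).2,
      Finset.sum_const, ← Nat.cast_smul_eq_nsmul ℝ, smul_smul, inv_mul_cancel₀ hScard, one_smul]
  have hinv : ∀ y ∈ W', ∀ y' ∈ W', c.proj y = c.proj y' → uAvg y = uAvg y' := by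
    intro y hy y' hy' hyy
    obtain ⟨g, rfl⟩ := (c.proj_eq_iff y (hW'dom hy) y' (hW'dom hy')).1 hyy
    have hg : c.act g z = z := by
      by_contra h
      exact hN2 g h y (hW'N y hy g) (hW'N _ hy' g)
    simp only [uAvg]
    congr 1
    refine (Finset.sum_equiv (Equiv.mulRight g) (fun a => ?_) fun a _ => ?_).symm
    · simp only [S, Finset.mem_filter, Finset.mem_univ, true_and, Equiv.coe_mulRight]
      rw [c.act_mul a g z hz, hg]
    · rw [Equiv.coe_mulRight, c.act_mul a g y (hW'dom hy)]
  -- The average descends to the image of `W'`.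
  let s : X → ℂ := fun p => if h : ∃ y ∈ W', c.proj y = p then uAvg h.choose else 0
  have hs : ∀ y ∈ W', s (c.proj y) = uAvg y := by
    intro y hy
    have h : ∃ y' ∈ W', c.proj y' = c.proj y := ⟨y, hy, rfl⟩
    simp only [s, dif_pos h]
    exact hinv _ h.choose_spec.1 _ hy h.choose_spec.2
  refine ⟨⟨c.proj '' W', c.isOpen_image_proj W' hW'dom hW'⟩, ⟨z, hzW', rfl⟩, s, ?_⟩
  rintro j z' hz' ⟨y, hy, hyz⟩
  obtain ⟨φ, hφ, hz'φ, hφz⟩ := M.compatible j i z' hz' y (hW'dom hy) hyz.symm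
  have hsol := hθ.solution_comp hA hφ hz'φ (u := uAvg) (by rw [hφz]; exact (huAvg y hy).1)
    (by rw [hφz]; exact (huAvg y hy).2)
  have heq : (fun y => s ((M.chart j).proj y)) =ᶠ[nhds z'] fun y => uAvg (φ y) := by
    filter_upwards [φ.open_source.mem_nhds hz'φ,
      (hφ.contDiffAt hz'φ).continuousAt.preimage_mem_nhds
        (hW'.mem_nhds (by rw [hφz]; exact hy))] with p hp hpW
    rw [← hφ.proj_apply p hp]
    exact hs _ hpW
  exact ⟨hsol.1.congr_of_eventuallyEq heq, by rw [heq.fderiv_eq]; exact hsol.2⟩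

/-- If the solutions of the homogeneous equation `A (ds) = 0` are the sections of a sheaf with
vanishing first cohomology, then the equation `A (ds) = θ` has a global solution as soon as it has
local solutions on the chart domains. -/
theorem IsCompatibleFamily.exists_isSolution_univ (hθ : M.IsCompatibleFamily θ)
    (hA : ∀ L (T : (Fin n → ℂ) →L[ℂ] (Fin n → ℂ)),
      A (L.comp (T.restrictScalars ℝ)) = (A L).comp (T.restrictScalars ℝ))
    (hloc : ∀ i, ∀ z ∈ (M.chart i).dom, ∃ u : (Fin n → ℂ) → ℂ, ∃ W ⊆ (M.chart i).dom,
      IsOpen W ∧ z ∈ W ∧ ContDiffOn ℝ ((⊤ : ℕ∞) : WithTop ℕ∞) u W ∧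
        ∀ y ∈ W, A (fderiv ℝ u y) = θ i y)
    (P : FunctionCondition X) (hP : Subsingleton (Sheaf.H P.sheaf 1))
    (hPA : ∀ (U : Opens X) (s : X → ℂ), (fun p : U => s p) ∈ P.sections U ↔
      M.IsSolution A 0 U s) :
    ∃ t : X → ℂ, M.IsSolution A θ univ t := by
  choose U hU s hs using hθ.exists_isSolution_nhds hA hloc
  obtain ⟨t, ht⟩ := P.exists_sub_mem_sections hP U (fun x => ⟨x, hU x⟩) s fun a b => by
    refine (hPA (U a ⊓ U b) fun p => s a p - s b p).2 fun i z hz hzU => ?_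
    obtain ⟨ha, hAa⟩ := hs a i z hz hzU.1
    obtain ⟨hb, hAb⟩ := hs b i z hz hzU.2
    refine ⟨ha.sub hb, ?_⟩
    rw [fderiv_fun_sub (ha.differentiableAt (by simp)) (hb.differentiableAt (by simp)), map_sub,
      hAa, hAb, sub_self]
    rfl
  refine ⟨t, fun i z hz _ => ?_⟩
  let a := (M.chart i).proj z
  obtain ⟨ha, hAa⟩ := hs a i z hz (hU a)
  obtain ⟨hb, hAb⟩ := (hPA (U a) fun p => t p - s a p).1 (ht a) i z hz (hU a)
  have heq : (fun y => t ((M.chart i).proj y)) = fun y =>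
      (t ((M.chart i).proj y) - s a ((M.chart i).proj y)) + s a ((M.chart i).proj y) := by
    ext y
    ring
  rw [heq]
  refine ⟨hb.add ha, ?_⟩
  rw [fderiv_fun_add (hb.differentiableAt (by simp)) (ha.differentiableAt (by simp)), map_add,
    hAa, hAb]
  exact zero_add _

end ComplexOrbifold

end Orbifold

/-! ### Solutions of the homogeneous equations -/

section Kernels

open Set

variable {n : ℕ} {X : Type u} [TopologicalSpace X]

namespace ComplexOrbifold

variable {M : ComplexOrbifold.{u, v, w} n X}

theorem isOpen_dom_inter_preimage (i : M.ι) (U : Opens X) :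
    IsOpen ((M.chart i).dom ∩ (M.chart i).proj ⁻¹' U) :=
  (M.chart i).continuousOn_proj.isOpen_inter_preimage (M.chart i).isOpen_dom U.isOpen

/-- The holomorphic functions are the solutions of `∂̄s = 0`. -/
theorem mem_holomorphicFunctions_iff (U : Opens X) (s : X → ℂ) :
    (fun p : U => s p) ∈ M.holomorphicFunctions.sections U ↔
      M.IsSolution conjLinearPart 0 U s := by
  have hext : ∀ i, EqOn (fun z => Function.extend Subtype.val (fun p : U => s p) (0 : X → ℂ)
      ((M.chart i).proj z)) (fun z => s ((M.chart i).proj z))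
      ((M.chart i).dom ∩ (M.chart i).proj ⁻¹' U) := fun i z hz =>
    Subtype.val_injective.extend_apply (fun p : U => s p) 0 ⟨_, hz.2⟩
  constructor
  · intro h i z hz hzU
    have hd : DifferentiableOn ℂ (fun z => s ((M.chart i).proj z))
      ((M.chart i).dom ∩ (M.chart i).proj ⁻¹' U) := (h i).congr fun z hz => (hext i hz).symm
    have hn := (isOpen_dom_inter_preimage i U).mem_nhds ⟨hz, hzU⟩
    exact ⟨((hd.contDiffOn_of_complex (isOpen_dom_inter_preimage i U)).contDiffAt
      hn).restrict_scalars ℝ, conjLinearPart_fderiv_of_complex (hd.differentiableAt hn)⟩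
  · intro h i
    refine DifferentiableOn.congr (f := fun z => s ((M.chart i).proj z)) (fun z hz => ?_) (hext i)
    obtain ⟨h1, h2⟩ := h i z hz.1 hz.2
    exact ((h1.differentiableAt (by simp)).complex_of_conjLinearPart_eq_zero
      h2).differentiableWithinAt

/-- A function whose derivative vanishes in all charts over an open set is locally constant there. -/
theorem exists_isOpen_eq_of_fderiv_eq_zero {E : Type*} [NormedAddCommGroup E] [NormedSpace ℝ E]
    {U : Opens X} {s : X → E}
    (h : ∀ i, ∀ z ∈ (M.chart i).dom, (M.chart i).proj z ∈ U →
      DifferentiableAt ℝ (fun y => s ((M.chart i).proj y)) z ∧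
        fderiv ℝ (fun y => s ((M.chart i).proj y)) z = 0) {x : X} (hx : x ∈ U) :
    ∃ V : Set X, IsOpen V ∧ x ∈ V ∧ ∀ y ∈ V, s y = s x := by
  obtain ⟨i, z, hz, rfl⟩ := M.covers x
  obtain ⟨r, hr, hrs⟩ := Metric.isOpen_iff.1 (isOpen_dom_inter_preimage i U) z ⟨hz, hx⟩
  refine ⟨(M.chart i).proj '' Metric.ball z r, (M.chart i).isOpen_image_proj _
    (fun y hy => (hrs hy).1) Metric.isOpen_ball, ⟨z, Metric.mem_ball_self hr, rfl⟩, ?_⟩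
  rintro _ ⟨y, hy, rfl⟩
  exact (convex_ball z r).is_const_of_fderivWithin_eq_zero
    (f := fun y => s ((M.chart i).proj y))
    (fun p hp => (h i p (hrs hp).1 (hrs hp).2).1.differentiableWithinAt)
    (fun p hp => by
      rw [fderivWithin_of_isOpen Metric.isOpen_ball hp]
      exact (h i p (hrs hp).1 (hrs hp).2).2) hy (Metric.mem_ball_self hr)

/-- The locally constant functions are the solutions of `ds = 0`. -/
theorem mem_locallyConstantFunctions_iff (U : Opens X) (s : X → ℂ) :
    (fun p : U => s p) ∈ (locallyConstantFunctions X).sections U ↔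
      M.IsSolution (ContinuousLinearMap.id ℝ _) 0 U s := by
  constructor
  · intro h i z hz hzU
    obtain ⟨W, hW, hxW, hc⟩ := IsLocallyConstant.exists_open h ⟨_, hzU⟩
    obtain ⟨V, hV, rfl⟩ := isOpen_induced_iff.1 hW
    have heq : (fun y => s ((M.chart i).proj y)) =ᶠ[nhds z] fun _ => s ((M.chart i).proj z) := by
      filter_upwards [(isOpen_dom_inter_preimage i (U ⊓ ⟨V, hV⟩)).mem_nhds ⟨hz, hzU, hxW⟩]
        with y hy
      exact hc ⟨_, hy.2.1⟩ hy.2.2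
    exact ⟨contDiffAt_const.congr_of_eventuallyEq heq, by rw [heq.fderiv_eq]; simp⟩
  · intro h
    refine (IsLocallyConstant.iff_exists_open _).2 fun x => ?_
    obtain ⟨V, hV, hxV, hc⟩ := exists_isOpen_eq_of_fderiv_eq_zero (M := M)
      (fun i z hz hzU => ⟨(h i z hz hzU).1.differentiableAt (by simp), (h i z hz hzU).2⟩) x.2
    exact ⟨Subtype.val ⁻¹' V, hV.preimage continuous_subtype_val, hxV, fun y hy => hc y.1 hy⟩

end ComplexOrbifold

end Kernels

/-! ### The operators `d` and `∂∂̄` in degrees zero and one -/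

section Forms

variable {n : ℕ}

theorem conjLinearPart_comp (L : (Fin n → ℂ) →L[ℝ] ℂ) (T : (Fin n → ℂ) →L[ℂ] (Fin n → ℂ)) :
    conjLinearPart (L.comp (T.restrictScalars ℝ)) =
      (conjLinearPart L).comp (T.restrictScalars ℝ) := by
  ext v
  simp [conjLinearPart_apply]

theorem conjLinearPart_conjLinearPart (L : (Fin n → ℂ) →L[ℝ] ℂ) :
    conjLinearPart (conjLinearPart L) = conjLinearPart L := by
  ext v
  rw [conjLinearPart_apply, conjLinearPart_smul_apply, Complex.conj_I]
  linear_combination (-(1 / 2) * conjLinearPart L v) * Complex.I_sq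

/-- A `1`-form at a point as a linear form. -/
noncomputable def oneFormEquiv :
    ((Fin n → ℂ) [⋀^Fin 1]→L[ℝ] ℂ) ≃ₗᵢ[ℝ] ((Fin n → ℂ) →L[ℝ] ℂ) :=
  (ContinuousAlternatingMap.ofSubsingletonLIE (𝕜 := ℝ) (E := Fin n → ℂ) (F := ℂ) (0 : Fin 1)).symm

theorem oneFormEquiv_apply (α : (Fin n → ℂ) [⋀^Fin 1]→L[ℝ] ℂ) (a : Fin n → ℂ) :
    oneFormEquiv α a = α fun _ => a := rfl

theorem oneFormEquiv_symm_apply (L : (Fin n → ℂ) →L[ℝ] ℂ) (a : Fin 1 → Fin n → ℂ) :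
    oneFormEquiv.symm L a = L (a 0) := rfl

theorem alternatizeUncurryFin_one_apply
    (L : (Fin n → ℂ) →L[ℝ] (Fin n → ℂ) [⋀^Fin 1]→L[ℝ] ℂ) (a : Fin 2 → Fin n → ℂ) :
    ContinuousAlternatingMap.alternatizeUncurryFin L a =
      oneFormEquiv (L (a 0)) (a 1) - oneFormEquiv (L (a 1)) (a 0) := by
  have h0 : Fin.removeNth 0 a = fun _ => a 1 := by
    ext i
    fin_cases i
    rfl
  have h1 : Fin.removeNth 1 a = fun _ => a 0 := by
    ext i
    fin_cases i
    rfl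
  rw [ContinuousAlternatingMap.alternatizeUncurryFin_apply, Fin.sum_univ_two, h0, h1]
  simp [oneFormEquiv_apply, sub_eq_add_neg]

/-- The form `∂̄F` of a function `F` is the antilinear part of its derivative. -/
theorem delbar_zeroForm (F : (Fin n → ℂ) → ℂ) (z : Fin n → ℂ) :
    delbar (zeroForm F) z = oneFormEquiv.symm (conjLinearPart (fderiv ℝ F z)) := by
  have h : zeroForm F =
      ContinuousAlternatingMap.constOfIsEmptyLIE ℝ (Fin n → ℂ) ℂ (Fin 0) ∘ F := rfl
  have hd := (ContinuousAlternatingMap.constOfIsEmptyLIE ℝ (Fin n → ℂ) ℂ (Fin 0)).comp_fderiv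
    (f := F) (x := z)
  ext a
  rw [delbar, ContinuousAlternatingMap.alternatizeUncurryFin_apply, Fin.sum_univ_one,
    oneFormEquiv_symm_apply, h, hd]
  simp [antilinearPart, conjLinearPart_apply]
  ring

/-- The form `∂∂̄F` of a function `F` in terms of its second derivative. -/
theorem del_delbar_zeroForm_apply {F : (Fin n → ℂ) → ℂ} {z : Fin n → ℂ}
    (hF : ContDiffAt ℝ 2 F z) (a : Fin 2 → Fin n → ℂ) :
    del (delbar (zeroForm F)) z a = Complex.I / 2 *
      (fderiv ℝ (fderiv ℝ F) z (a 0) (Complex.I • a 1) -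
        fderiv ℝ (fderiv ℝ F) z (Complex.I • a 0) (a 1)) := by
  have hsymm : IsSymmSndFDerivAt ℝ F z := hF.isSymmSndFDerivAt (by simp)
  have hd : DifferentiableAt ℝ (fderiv ℝ F) z :=
    (hF.fderiv_right (m := 1) (by norm_num)).differentiableAt one_ne_zero
  have h : delbar (zeroForm F) = fun z => oneFormEquiv.symm (conjLinearPart (fderiv ℝ F z)) :=
    funext (delbar_zeroForm F)
  have hD : ∀ b, oneFormEquiv (fderiv ℝ (delbar (zeroForm F)) z b) =
      conjLinearPart (fderiv ℝ (fderiv ℝ F) z b) := by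
    intro b
    have h1 := ((oneFormEquiv.symm.toContinuousLinearEquiv.toContinuousLinearMap.comp
      conjLinearPart).hasFDerivAt.comp z hd.hasFDerivAt).fderiv
    rw [h]
    refine (congrArg (fun L => oneFormEquiv (L b)) h1).trans ?_
    exact oneFormEquiv.apply_symm_apply _
  have hL : ∀ b, oneFormEquiv (linearPart (fderiv ℝ (delbar (zeroForm F)) z) b) =
      (1 / 2 : ℂ) • (conjLinearPart (fderiv ℝ (fderiv ℝ F) z b) -
        Complex.I • conjLinearPart (fderiv ℝ (fderiv ℝ F) z (Complex.I • b))) := by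
    intro b
    rw [← hD, ← hD]
    rfl
  rw [del, alternatizeUncurryFin_one_apply, hL, hL]
  simp only [smul_apply, sub_apply, conjLinearPart_apply, smul_eq_mul]
  rw [hsymm.eq (a 1) (a 0), hsymm.eq (a 1) (Complex.I • a 0), hsymm.eq (Complex.I • a 1) (a 0),
    hsymm.eq (Complex.I • a 1) (Complex.I • a 0)]
  ring

/-- The exterior derivative of a `1`-form. -/
theorem extDeriv_one_apply {ω : (Fin n → ℂ) → (Fin n → ℂ) [⋀^Fin 1]→L[ℝ] ℂ} {z : Fin n → ℂ}
    (a : Fin 2 → Fin n → ℂ) :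
    extDeriv ω z a =
      fderiv ℝ ω z (a 0) (fun _ => a 1) - fderiv ℝ ω z (a 1) (fun _ => a 0) := by
  rw [extDeriv, alternatizeUncurryFin_one_apply]
  rfl

/-- The real part of a `1`-form, as a linear form with complex values. -/
noncomputable def reOneForm :
    ((Fin n → ℂ) [⋀^Fin 1]→L[ℝ] ℂ) →L[ℝ] ((Fin n → ℂ) →L[ℝ] ℂ) :=
  (ContinuousLinearMap.compL ℝ (Fin n → ℂ) ℂ ℂ (Complex.ofRealCLM.comp Complex.reCLM)).comp
    oneFormEquiv.toContinuousLinearEquiv.toContinuousLinearMap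

theorem reOneForm_apply (α : (Fin n → ℂ) [⋀^Fin 1]→L[ℝ] ℂ) (a : Fin n → ℂ) :
    reOneForm α a = ((α fun _ => a).re : ℂ) := rfl

theorem fderiv_reOneForm {ω : (Fin n → ℂ) → (Fin n → ℂ) [⋀^Fin 1]→L[ℝ] ℂ} {z : Fin n → ℂ}
    (hω : DifferentiableAt ℝ ω z) (a b : Fin n → ℂ) :
    fderiv ℝ (fun y => reOneForm (ω y)) z a b = ((fderiv ℝ ω z a fun _ => b).re : ℂ) := by
  have h := (reOneForm.hasFDerivAt.comp z hω.hasFDerivAt).fderiv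
  exact congrArg (fun L => L a b) h

/-- If `∂̄u` is the `(0,1)`-part of a form `r` with real values, then `dr = 2i ∂∂̄ (Im u)`. -/
theorem fderiv_sub_fderiv_eq_of_conjLinearPart_fderiv_eq {u : (Fin n → ℂ) → ℂ}
    {r : (Fin n → ℂ) → (Fin n → ℂ) →L[ℝ] ℂ} {z : Fin n → ℂ} (hu : ContDiffAt ℝ 2 u z)
    (hr : ∀ y a, (r y a).im = 0) (hrd : DifferentiableAt ℝ r z)
    (h : ∀ᶠ y in nhds z, conjLinearPart (fderiv ℝ u y) = conjLinearPart (r y))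
    (a b : Fin n → ℂ) :
    fderiv ℝ r z a b - fderiv ℝ r z b a =
      fderiv ℝ (fderiv ℝ fun y => ((u y).im : ℂ)) z (Complex.I • a) b -
        fderiv ℝ (fderiv ℝ fun y => ((u y).im : ℂ)) z a (Complex.I • b) := by
  let p : (Fin n → ℂ) → ℂ := fun y => ((u y).re : ℂ)
  let q : (Fin n → ℂ) → ℂ := fun y => ((u y).im : ℂ)
  have hp : ContDiffAt ℝ 2 p z :=
    (Complex.ofRealCLM.comp Complex.reCLM).contDiff.contDiffAt.comp z hu
  have hq : ContDiffAt ℝ 2 q z :=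
    (Complex.ofRealCLM.comp Complex.imCLM).contDiff.contDiffAt.comp z hu
  have hpd : DifferentiableAt ℝ (fderiv ℝ p) z :=
    (hp.fderiv_right (m := 1) (by norm_num)).differentiableAt one_ne_zero
  have hqd : DifferentiableAt ℝ (fderiv ℝ q) z :=
    (hq.fderiv_right (m := 1) (by norm_num)).differentiableAt one_ne_zero
  have hpsymm : IsSymmSndFDerivAt ℝ p z := hp.isSymmSndFDerivAt (by simp)
  have hqsymm : IsSymmSndFDerivAt ℝ q z := hq.isSymmSndFDerivAt (by simp)
  -- The real part of the equation `conjLinearPart (du) = conjLinearPart r`.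
  have key : ∀ b, (fun y => r y b) =ᶠ[nhds z] fun y =>
      fderiv ℝ p y b - fderiv ℝ q y (Complex.I • b) := by
    intro b
    filter_upwards [h, hu.eventually (by simp)] with y hy huy
    have hud := (huy.differentiableAt two_ne_zero).hasFDerivAt
    have hp' : fderiv ℝ p y = _ :=
      ((Complex.ofRealCLM.comp Complex.reCLM).hasFDerivAt.comp y hud).fderiv
    have hq' : fderiv ℝ q y = _ :=
      ((Complex.ofRealCLM.comp Complex.imCLM).hasFDerivAt.comp y hud).fderiv
    have h1 := congrArg (fun L => (L b).re) hy
    simp only [conjLinearPart_apply] at h1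
    rw [hp', hq']
    have h2 := hr y b
    have h3 := hr y (Complex.I • b)
    apply Complex.ext
    · simp at h1 ⊢
      linarith
    · simp [h2]
  have hD : ∀ a b, fderiv ℝ r z a b =
      fderiv ℝ (fderiv ℝ p) z a b - fderiv ℝ (fderiv ℝ q) z a (Complex.I • b) := by
    intro a b
    have h1 : fderiv ℝ (fun y => r y b) z a = fderiv ℝ r z a b := by
      rw [fderiv_clm_apply hrd (differentiableAt_const b)]
      simp
    rw [← h1, (key b).fderiv_eq, fderiv_fun_sub (hpd.clm_apply (differentiableAt_const _))
      (hqd.clm_apply (differentiableAt_const _)), fderiv_clm_apply hpd (differentiableAt_const _),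
      fderiv_clm_apply hqd (differentiableAt_const _)]
    simp
  rw [hD, hD, hpsymm.eq b a, hqsymm.eq b]
  ring

end Forms

/-! ### Existence and uniqueness of potentials -/

namespace ComplexOrbifold

open Set

variable {n : ℕ} {X : Type u} [TopologicalSpace X] {M : ComplexOrbifold.{u, v, w} n X}

theorem IsCompatibleFamily.conjLinearPart {θ : M.ι → (Fin n → ℂ) → (Fin n → ℂ) →L[ℝ] ℂ}
    (hθ : M.IsCompatibleFamily θ) :
    M.IsCompatibleFamily fun i z => _root_.conjLinearPart (θ i z) := by
  intro i j φ hφ z hz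
  simp only
  rw [← hθ i j φ hφ z hz, ((hφ.differentiableAt hz).hasFDerivAt.restrictScalars ℝ).fderiv,
    conjLinearPart_comp]

theorem IsCompatibleFamily.sub {θ θ' : M.ι → (Fin n → ℂ) → (Fin n → ℂ) →L[ℝ] ℂ}
    (hθ : M.IsCompatibleFamily θ) (hθ' : M.IsCompatibleFamily θ') :
    M.IsCompatibleFamily fun i z => θ i z - θ' i z := by
  intro i j φ hφ z hz
  simp only
  rw [← hθ i j φ hφ z hz, ← hθ' i j φ hφ z hz, ContinuousLinearMap.sub_comp]

theorem SmoothForm.isCompatibleFamily_reOneForm (η : M.SmoothForm 1) :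
    M.IsCompatibleFamily fun i z => reOneForm (η.toFun i z) := by
  intro i j φ hφ z hz
  simp only
  rw [← η.pullback i j φ hφ z hz]
  rfl

theorem isCompatibleFamily_fderiv {s : X → ℂ}
    (hs : ∀ i, ∀ z ∈ (M.chart i).dom, DifferentiableAt ℝ (fun y => s ((M.chart i).proj y)) z) :
    M.IsCompatibleFamily fun i z => fderiv ℝ (fun y => s ((M.chart i).proj y)) z := by
  intro i j φ hφ z hz
  have hd := (hφ.differentiableAt hz).restrictScalars ℝ
  have heq : (fun y => s ((M.chart i).proj y)) =ᶠ[nhds z]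
      (fun y => s ((M.chart j).proj y)) ∘ φ := by
    filter_upwards [φ.open_source.mem_nhds hz] with y hy
    simp only [Function.comp_apply, hφ.proj_apply y hy]
  simp only
  rw [heq.fderiv_eq, fderiv_comp z (hs j _ (hφ.target_subset (φ.map_source hz))) hd]

theorem IsSmooth.contDiffAt {f : X → ℝ} (hf : M.IsSmooth f) {i : M.ι} {z : Fin n → ℂ}
    (hz : z ∈ (M.chart i).dom) :
    ContDiffAt ℝ ((⊤ : ℕ∞) : WithTop ℕ∞) (fun y => (f ((M.chart i).proj y) : ℂ)) z :=
  Complex.ofRealCLM.contDiff.contDiffAt.comp z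
    ((hf i).contDiffAt ((M.chart i).isOpen_dom.mem_nhds hz))

/-- Existence of `∂∂̄`-potentials: if `ψ = dη` with `η` real, then the `(0,1)`-part of `η` is
`∂̄`-closed, hence equal to `∂̄t` for a function `t`, and `ψ = 2i ∂∂̄ (Im t)`. -/
theorem SmoothForm.exists_eqDelDelbar (hO1 : Subsingleton (Sheaf.H M.structureSheaf 1))
    (ψ : M.SmoothForm 2) (hreal : ψ.IsReal) (htype : ψ.IsOfType 1 1) (hexact : ψ.IsExact) :
    ∃ f : X → ℝ, M.IsSmooth f ∧ ψ.EqDelDelbar f := by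
  obtain ⟨η, hη⟩ := hexact
  let r : M.ι → (Fin n → ℂ) → (Fin n → ℂ) →L[ℝ] ℂ := fun i z => reOneForm (η.toFun i z)
  have hdη : ∀ i, ∀ z ∈ (M.chart i).dom, DifferentiableAt ℝ (η.toFun i) z := fun i z hz =>
    ((η.smooth i).contDiffAt ((M.chart i).isOpen_dom.mem_nhds hz)).differentiableAt (by simp)
  have hr : ∀ i, ContDiffOn ℝ ((⊤ : ℕ∞) : WithTop ℕ∞) (r i) (M.chart i).dom := fun i =>
    reOneForm.contDiff.comp_contDiffOn (η.smooth i)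
  -- `ψ` is the exterior derivative of the real part of `η`.
  have hdr : ∀ i, ∀ z ∈ (M.chart i).dom, ∀ a : Fin 2 → Fin n → ℂ,
      ψ.toFun i z a = fderiv ℝ (r i) z (a 0) (a 1) - fderiv ℝ (r i) z (a 1) (a 0) := by
    intro i z hz a
    rw [fderiv_reOneForm (hdη i z hz), fderiv_reOneForm (hdη i z hz)]
    have h1 := hreal i z hz a
    have h2 := congrArg (fun β => β a) (hη i z hz)
    simp only [extDeriv_one_apply] at h2
    rw [← Complex.re_add_im (ψ.toFun i z a), h1, h2]
    simp
  obtain ⟨t, ht⟩ := (η.isCompatibleFamily_reOneForm.conjLinearPart).exists_isSolution_univ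
    (A := _root_.conjLinearPart) conjLinearPart_comp (fun i z hz =>
      exists_conjLinearPart_fderiv_eq (M.chart i).isOpen_dom (hr i) (fun y hy a b => by
        have h1 := hdr i y hy ![a, b]
        have h2 := hdr i y hy fun j => Complex.I • ![a, b] j
        rw [htype i y hy, h1] at h2
        simpa using h2.symm) hz)
    M.holomorphicFunctions hO1 mem_holomorphicFunctions_iff
  have htim : ∀ i, ∀ z ∈ (M.chart i).dom, ContDiffAt ℝ ((⊤ : ℕ∞) : WithTop ℕ∞)
      (fun y => (t ((M.chart i).proj y)).im) z := fun i z hz =>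
    Complex.imCLM.contDiff.contDiffAt.comp z (ht i z hz trivial).1
  refine ⟨fun x => 4 * Real.pi * (t x).im, fun i z hz =>
    (contDiffAt_const.mul (htim i z hz)).contDiffWithinAt, fun i z hz => ?_⟩
  have h2 : ((2 : ℕ∞) : WithTop ℕ∞) ≤ ((⊤ : ℕ∞) : WithTop ℕ∞) := WithTop.coe_le_coe.2 le_top
  let q : (Fin n → ℂ) → ℂ := fun y => ((t ((M.chart i).proj y)).im : ℂ)
  have hq : ∀ y ∈ (M.chart i).dom, ContDiffAt ℝ 2 q y := fun y hy =>
    Complex.ofRealCLM.contDiff.contDiffAt.comp y ((htim i y hy).of_le h2)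
  have hf : (fun y => ((4 * Real.pi * (t ((M.chart i).proj y)).im : ℝ) : ℂ)) =
      (4 * Real.pi) • q := by
    ext y
    simp [q]
  have hdf : fderiv ℝ (fderiv ℝ ((4 * Real.pi) • q)) z =
      (4 * Real.pi) • fderiv ℝ (fderiv ℝ q) z := by
    have : fderiv ℝ ((4 * Real.pi) • q) = (4 * Real.pi) • fderiv ℝ q :=
      funext fun y => congrFun (fderiv_const_smul_field _) y
    rw [this]
    exact ((((hq z hz).fderiv_right (m := 1) (by norm_num)).differentiableAt
      one_ne_zero).hasFDerivAt.const_smul (4 * Real.pi)).fderiv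
  have hfs : ContDiffAt ℝ 2 ((4 * Real.pi) • q) z :=
    contDiffAt_const.smul (hq z hz)
  ext a
  rw [hf, ContinuousAlternatingMap.smul_apply, del_delbar_zeroForm_apply hfs, hdf, hdr i z hz,
    fderiv_sub_fderiv_eq_of_conjLinearPart_fderiv_eq ((ht i z hz trivial).1.of_le h2)
      (fun y a => by rw [reOneForm_apply, Complex.ofReal_im])
      ((hr i).contDiffAt ((M.chart i).isOpen_dom.mem_nhds hz) |>.differentiableAt (by simp))
      (by
        filter_upwards [(M.chart i).isOpen_dom.mem_nhds hz] with y hy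
        exact (ht i y hy trivial).2)]
  simp only [smul_apply, Complex.real_smul, smul_eq_mul]
  have hpi : (Real.pi : ℂ) ≠ 0 := by exact_mod_cast Real.pi_ne_zero
  push_cast
  field_simp
  linear_combination (4 * (fderiv ℝ (fderiv ℝ q) z (Complex.I • a 0) (a 1) -
    fderiv ℝ (fderiv ℝ q) z (a 0) (Complex.I • a 1))) * Complex.I_sq

/-- Uniqueness of `∂∂̄`-potentials: if `∂∂̄h = 0`, then the form `∂h` is closed, hence equal to `dt`
for a function `t`. Since `dt` is of type `(1,0)`, `t` is holomorphic and so constant, whence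
`∂h = 0`; as `h` is real this means `dh = 0`. -/
theorem IsSmooth.exists_eq_const_of_del_delbar_eq_zero [PreconnectedSpace X]
    (hO0 : ∀ h ∈ M.holomorphicFunctions.sections ⊤, ∃ c : ℂ, ∀ x, h x = c)
    (hC1 : Subsingleton (Sheaf.H (constantSheafC X) 1)) {h : X → ℝ} (hh : M.IsSmooth h)
    (hdd : ∀ i, ∀ z ∈ (M.chart i).dom,
      del (delbar (zeroForm fun y => (h ((M.chart i).proj y) : ℂ))) z = 0) :
    ∃ c : ℝ, ∀ x, h x = c := by
  let H : M.ι → (Fin n → ℂ) → ℂ := fun i y => (h ((M.chart i).proj y) : ℂ)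
  have hH : ∀ i, ∀ z ∈ (M.chart i).dom, ContDiffAt ℝ ((⊤ : ℕ∞) : WithTop ℕ∞) (H i) z :=
    fun i z hz => hh.contDiffAt hz
  have hHd : ∀ i, ∀ z ∈ (M.chart i).dom, DifferentiableAt ℝ (H i) z := fun i z hz =>
    (hH i z hz).differentiableAt (by simp)
  have h2 : ((2 : ℕ∞) : WithTop ℕ∞) ≤ ((⊤ : ℕ∞) : WithTop ℕ∞) := WithTop.coe_le_coe.2 le_top
  -- The family of the forms `∂h`.
  let α : M.ι → (Fin n → ℂ) → (Fin n → ℂ) →L[ℝ] ℂ := fun i z =>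
    fderiv ℝ (H i) z - conjLinearPart (fderiv ℝ (H i) z)
  have hHfam : M.IsCompatibleFamily fun i z => fderiv ℝ (H i) z :=
    isCompatibleFamily_fderiv (s := fun x => (h x : ℂ)) hHd
  have hαs : ∀ i, ContDiffOn ℝ ((⊤ : ℕ∞) : WithTop ℕ∞) (α i) (M.chart i).dom := by
    intro i
    have h1 : ContDiffOn ℝ ((⊤ : ℕ∞) : WithTop ℕ∞) (fderiv ℝ (H i)) (M.chart i).dom :=
      ContDiffOn.fderiv_of_isOpen (fun z hz => (hH i z hz).contDiffWithinAt)
        (M.chart i).isOpen_dom (by simp)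
    exact h1.sub (conjLinearPart.contDiff.comp_contDiffOn h1)
  have hαclosed : ∀ i, ∀ z ∈ (M.chart i).dom, ∀ a b,
      fderiv ℝ (α i) z a b = fderiv ℝ (α i) z b a := by
    intro i z hz a b
    have hH2 : ContDiffAt ℝ 2 (H i) z := (hH i z hz).of_le h2
    have hsymm : IsSymmSndFDerivAt ℝ (H i) z := hH2.isSymmSndFDerivAt (by simp)
    have hd : HasFDerivAt (fderiv ℝ (H i)) (fderiv ℝ (fderiv ℝ (H i)) z) z :=
      ((hH2.fderiv_right (m := 1) (by norm_num)).differentiableAt one_ne_zero).hasFDerivAt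
    have hα : fderiv ℝ (α i) z = fderiv ℝ (fderiv ℝ (H i)) z -
        conjLinearPart.comp (fderiv ℝ (fderiv ℝ (H i)) z) :=
      (hd.sub (conjLinearPart.hasFDerivAt.comp z hd)).fderiv
    have h0 : del (delbar (zeroForm (H i))) z ![a, b] = 0 := by
      rw [hdd i z hz]
      rfl
    rw [del_delbar_zeroForm_apply hH2] at h0
    have h0' : fderiv ℝ (fderiv ℝ (H i)) z a (Complex.I • b) =
        fderiv ℝ (fderiv ℝ (H i)) z (Complex.I • a) b := by
      simpa [sub_eq_zero] using h0
    simp only [hα, sub_apply, ContinuousLinearMap.comp_apply, conjLinearPart_apply]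
    rw [hsymm.eq b a, h0', hsymm.eq b]
  obtain ⟨t, ht⟩ := (hHfam.sub hHfam.conjLinearPart).exists_isSolution_univ
    (A := ContinuousLinearMap.id ℝ _) (fun _ _ => rfl) (fun i z hz => by
      obtain ⟨ρ, hρ, hball⟩ := Metric.isOpen_iff.1 (M.chart i).isOpen_dom z hz
      have hαd : DifferentiableOn ℝ (α i) (Metric.ball z ρ) :=
        ((hαs i).mono hball).differentiableOn (by simp)
      obtain ⟨u, hu⟩ := (convex_ball z ρ).exists_forall_hasFDerivAt_of_fderiv_symmetric
        Metric.isOpen_ball hαd fun y hy => hαclosed i y (hball hy)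
      refine ⟨u, Metric.ball z ρ, hball, Metric.isOpen_ball, Metric.mem_ball_self hρ, ?_,
        fun y hy => (hu y hy).fderiv⟩
      rw [contDiffOn_infty_iff_fderiv_of_isOpen Metric.isOpen_ball]
      exact ⟨fun y hy => (hu y hy).differentiableAt.differentiableWithinAt,
        ((hαs i).mono hball).congr fun y hy => (hu y hy).fderiv⟩)
    (locallyConstantFunctions X) hC1 mem_locallyConstantFunctions_iff
  have ht' : ∀ i, ∀ z ∈ (M.chart i).dom,
      fderiv ℝ (fun y => t ((M.chart i).proj y)) z = α i z := fun i z hz => (ht i z hz trivial).2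
  obtain ⟨c, hc⟩ := hO0 (fun p => t p) ((mem_holomorphicFunctions_iff ⊤ t).2 fun i z hz _ =>
    ⟨(ht i z hz trivial).1, by
      rw [ht' i z hz, map_sub, conjLinearPart_conjLinearPart, sub_self]
      rfl⟩)
  have hdH : ∀ i, ∀ z ∈ (M.chart i).dom, fderiv ℝ (H i) z = 0 := by
    intro i z hz
    have hconst : (fun y => t ((M.chart i).proj y)) = fun _ => c := funext fun y => hc ⟨_, trivial⟩
    have hα0 : α i z = 0 := by
      rw [← ht' i z hz, hconst, fderiv_fun_const]
      rfl
    have hreal : ∀ a, (fderiv ℝ (H i) z a).im = 0 := by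
      intro a
      have hd : DifferentiableAt ℝ (fun y => h ((M.chart i).proj y)) z :=
        ((hh i).contDiffAt ((M.chart i).isOpen_dom.mem_nhds hz)).differentiableAt (by simp)
      have h1 : fderiv ℝ (H i) z = _ := (Complex.ofRealCLM.hasFDerivAt.comp z hd.hasFDerivAt).fderiv
      rw [h1]
      exact Complex.ofReal_im _
    ext a
    have h1 := congrArg (fun L => (L a).re) hα0
    simp only [α, sub_apply, conjLinearPart_apply, zero_apply] at h1
    apply Complex.ext
    · have h3 := hreal (Complex.I • a)
      simp at h1 ⊢
      linarith
    · exact hreal a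
  have hlc : IsLocallyConstant h := by
    refine (IsLocallyConstant.iff_exists_open h).2 fun x => ?_
    obtain ⟨V, hV, hxV, hVc⟩ := exists_isOpen_eq_of_fderiv_eq_zero (M := M) (U := ⊤)
      (s := fun x => (h x : ℂ)) (fun i z hz _ => ⟨hHd i z hz, hdH i z hz⟩) (x := x) trivial
    exact ⟨V, hV, hxV, fun y hy => Complex.ofReal_injective (hVc y hy)⟩
  rcases isEmpty_or_nonempty X with hX | ⟨⟨x⟩⟩
  · exact ⟨0, fun x => hX.elim x⟩
  · exact ⟨h x, fun y => hlc.apply_eq_of_preconnectedSpace y x⟩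

end ComplexOrbifold

theorem mainTheorem5 {n : ℕ} {X : Type u} [TopologicalSpace X] [T2Space X] [ParacompactSpace X]
    [ConnectedSpace X] (M : ComplexOrbifold.{u, v, w} n X)
    (hO0 : ∀ h ∈ M.holomorphicFunctions.sections ⊤, ∃ c : ℂ, ∀ x, h x = c)
    (hC1 : Subsingleton (Sheaf.H (constantSheafC X) 1))
    (hO1 : Subsingleton (Sheaf.H M.structureSheaf 1))
    (ψ : M.SmoothForm 2) (hreal : ψ.IsReal)
    (htype : ψ.IsOfType 1 1) (hexact : ψ.IsExact) :
    (∃ f : X → ℝ, M.IsSmooth f ∧ ψ.EqDelDelbar f) ∧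
      ∀ f g : X → ℝ, M.IsSmooth f → ψ.EqDelDelbar f → M.IsSmooth g → ψ.EqDelDelbar g →
        ∃ c : ℝ, ∀ x, f x = g x + c := by
  refine ⟨ψ.exists_eqDelDelbar hO1 hreal htype hexact, fun f g hf hψf hg hψg => ?_⟩
  have hsub : M.IsSmooth fun x => f x - g x := fun i => (hf i).sub (hg i)
  obtain ⟨c, hc⟩ := hsub.exists_eq_const_of_del_delbar_eq_zero hO0 hC1 fun i z hz => by
    have h2 : ((2 : ℕ∞) : WithTop ℕ∞) ≤ ((⊤ : ℕ∞) : WithTop ℕ∞) := WithTop.coe_le_coe.2 le_top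
    have hF : ∀ y ∈ (M.chart i).dom, ContDiffAt ℝ 2
        (fun y => (f ((M.chart i).proj y) : ℂ)) y := fun y hy => (hf.contDiffAt hy).of_le h2
    have hG : ∀ y ∈ (M.chart i).dom, ContDiffAt ℝ 2
        (fun y => (g ((M.chart i).proj y) : ℂ)) y := fun y hy => (hg.contDiffAt hy).of_le h2
    have hd2 : fderiv ℝ (fderiv ℝ fun y =>
        ((f ((M.chart i).proj y) - g ((M.chart i).proj y) : ℝ) : ℂ)) z = fderiv ℝ (fderiv ℝ fun y => (f ((M.chart i).proj y) : ℂ)) z -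
          fderiv ℝ (fderiv ℝ fun y => (g ((M.chart i).proj y) : ℂ)) z := by
      rw [← fderiv_sub
        (((hF z hz).fderiv_right (m := 1) (by norm_num)).differentiableAt one_ne_zero)
        (((hG z hz).fderiv_right (m := 1) (by norm_num)).differentiableAt one_ne_zero)]
      refine Filter.EventuallyEq.fderiv_eq ?_
      filter_upwards [(M.chart i).isOpen_dom.mem_nhds hz] with y hy
      simp only [Complex.ofReal_sub]
      exact fderiv_fun_sub ((hF y hy).differentiableAt two_ne_zero)
        ((hG y hy).differentiableAt two_ne_zero)
    ext a
    have heq := congrArg (fun β => β a) ((hψf i z hz).symm.trans (hψg i z hz))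
    simp only [ContinuousAlternatingMap.smul_apply, del_delbar_zeroForm_apply (hF z hz),
      del_delbar_zeroForm_apply (hG z hz), smul_eq_mul] at heq
    have hne : Complex.I / (2 * Real.pi) ≠ 0 := div_ne_zero Complex.I_ne_zero (by simp)
    have heq' := mul_left_cancel₀ hne heq
    rw [del_delbar_zeroForm_apply ((hsub.contDiffAt hz).of_le h2), hd2]
    simp only [sub_apply]
    change _ = (0 : ℂ)
    linear_combination heq'
  exact ⟨c, fun x => by linarith [hc x]⟩
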